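/- Fix a finite set $\sigma$ of labels with $|\sigma|>1$. A labeled graph $H=(V,E,\lambda)$ consists of a non-empty finite set $V$ of vertices, a set $E\subseteq V^2$ of directed edges, and a labeling function $\lambda:E\to\sigma$ (so there are no multi-edges). A homomorphism $h:G\to H$ between labeled graphs is a function on the vertices such that for every edge $(u,v)$ of $G$, $(h(u),h(v))$ is an edge of $H$ with the same label; write $G\leadsto H$ if one exists. A subgraph $H'\subseteq H$ has the same vertex set $V$, a subset $E'\subseteq E$ of the edges, and the restricted labeling. A probabilistic graph $(H,\pi)$ is a labeled graph $H$ with a function $\pi:E\to[0,1]\cap\mathbb{Q}$; set $$\Pr(G\leadsto H)=\sum_{\substack{H'=(V,E',\lambda|_{E'})\subseteq H\\ G\leadsto H'}}\ \prod_{e\in E'}\pi(e)\prod_{e\in E\setminus E'}(1-\pi(e)).$$ A labeled graph is connected if its underlying undirected graph is connected. It is a two-way path if its vertices can be enumerated without repetition as $a_1,\dots,a_m$ ($m\ge 1$) such that for each $1\le i<m$ exactly one of $(a_i,a_{i+1})$, $(a_{i+1},a_i)$ is an edge (with an arbitrary label), and there are no other edges. Proposition. The following problem can be solved by a deterministic Turing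 machine in time polynomial in the total size of the input: given a connected labeled graph $G$ and a probabilistic graph $(H,\pi)$ such that $H$ is a two-way path, compute the probability $\Pr(G\leadsto H)$. Here graphs are given by listing their vertices and their labeled edges, and vertex names and rational numbers (as fractions of natural numbers, not necessarily in lowest terms) are written in binary; the output is a fraction that represents $\Pr(G\leadsto H)$. -/

import Mathlib

namespace PHom

/-- A directed graph with vertex set `V` and edge labels from `σ`: a finite set `E ⊆ V²` of edges
and a labeling function `E → σ` (so there are no multi-edges; self-loops are allowed). -/
structure LabeledGraph (V σ : Type) where
  edges : Finset (V × V)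
  label : edges → σ

namespace LabeledGraph

variable {V W σ : Type}

/-- `h` is a graph homomorphism from `G` to `H`: every edge is mapped to an edge with the same
label. -/
def IsHom (G : LabeledGraph V σ) (H : LabeledGraph W σ) (h : V → W) : Prop :=
  ∀ e : G.edges, ∃ he : (h e.1.1, h e.1.2) ∈ H.edges, H.label ⟨_, he⟩ = G.label e

/-- There is a homomorphism from `G` to `H`. -/
def HomTo (G : LabeledGraph V σ) (H : LabeledGraph W σ) : Prop :=
  ∃ h : V → W, IsHom G H h

/-- The subgraph of `H` with the same vertices, whose edges are those of `E'`, with the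
restricted labeling. -/
def subgraph (H : LabeledGraph W σ) (E' : Finset H.edges) : LabeledGraph W σ where
  edges := E'.map (Function.Embedding.subtype _)
  label e := H.label ⟨e.1, by
    obtain ⟨a, _, ha⟩ := Finset.mem_map.1 e.2
    exact ha ▸ a.2⟩

/-- The probability of the possible world of `(H, π)` that keeps exactly the edges in `E'`: edges
are kept independently, each edge `e` with probability `π e`. -/
def worldProb [DecidableEq W] (H : LabeledGraph W σ) (π : H.edges → ℚ) (E' : Finset H.edges) : ℚ :=
  (∏ e ∈ E', π e) * ∏ e ∈ E'ᶜ, (1 - π e)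

open Classical in
/-- The probability `Pr(G ⇝ H)` that `G` has a homomorphism to the probabilistic graph `(H, π)`:
the sum of the probabilities of all subgraphs of `H` to which `G` has a homomorphism. -/
noncomputable def homProb [DecidableEq W] (G : LabeledGraph V σ) (H : LabeledGraph W σ)
    (π : H.edges → ℚ) : ℚ :=
  ∑ E' : Finset H.edges with G.HomTo (H.subgraph E'), H.worldProb π E'

/-- `G` is connected: it is non-empty and its underlying undirected graph is connected. -/
def IsConnected (G : LabeledGraph V σ) : Prop :=
  (SimpleGraph.fromRel fun u v => (u, v) ∈ G.edges).Connected

/-- `G` is a two-way path `a 0 - a 1 - ⋯ - a m`: the `a i` enumerate the vertices without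
repetition, consecutive vertices are joined by an edge in exactly one direction, and there are no
other edges. -/
def IsTwoWayPath (G : LabeledGraph V σ) : Prop :=
  ∃ (m : ℕ) (a : Fin (m + 1) → V), Function.Bijective a ∧
    (∀ i : Fin m, Xor ((a i.castSucc, a i.succ) ∈ G.edges) ((a i.succ, a i.castSucc) ∈ G.edges)) ∧
    ∀ e ∈ G.edges, ∃ i : Fin m, e = (a i.castSucc, a i.succ) ∨ e = (a i.succ, a i.castSucc)

/-- The edges of a graph on `{0, …, n - 1}`, in lexicographic order. -/
def edgeList {n : ℕ} (G : LabeledGraph (Fin n) σ) : List G.edges :=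
  (List.finRange n ×ˢ List.finRange n).filterMap fun e =>
    if h : e ∈ G.edges then some ⟨e, h⟩ else none

end LabeledGraph

/-- A rational number of `[0, 1]` represented by a fraction of natural numbers, which need not be
in lowest terms. -/
structure ProbFraction where
  num : ℕ
  den : ℕ
  den_pos : 0 < den
  num_le_den : num ≤ den

/-- The rational number that a fraction represents. -/
def ProbFraction.toRat (q : ProbFraction) : ℚ := q.num / q.den

/-- A class of labeled graphs, presented on the vertex sets `{0, …, n - 1}`. -/
abbrev GraphClass (σ : Type) := ∀ n : ℕ, LabeledGraph (Fin n) σ → Prop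

/-- The class of connected graphs. -/
def Connected (σ : Type) : GraphClass σ := fun _ G => G.IsConnected

/-- The class of two-way paths. -/
def TwoWayPath (σ : Type) : GraphClass σ := fun _ G => G.IsTwoWayPath

/-- The inputs of the probabilistic homomorphism problem for query graphs in `𝒢` and instance
graphs in `ℋ`: a non-empty graph `G` in `𝒢` and a non-empty probabilistic graph `(H, π)` with `H`
in `ℋ`. -/
structure Input {σ : Type} (𝒢 ℋ : GraphClass σ) where
  nG : ℕ
  nG_pos : 0 < nG
  G : LabeledGraph (Fin nG) σ
  G_mem : 𝒢 nG G
  nH : ℕ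
  nH_pos : 0 < nH
  H : LabeledGraph (Fin nH) σ
  H_mem : ℋ nH H
  prob : H.edges → ProbFraction

/-- The number to be computed on a given input. -/
noncomputable def Input.answer {σ : Type} {𝒢 ℋ : GraphClass σ} (x : Input 𝒢 ℋ) : ℚ :=
  x.G.homProb x.H fun e => (x.prob e).toRat

/-- The alphabet of the encodings: bits, the labels, and two separators. -/
inductive Symbol (σ : Type)
  | bit (b : Bool)
  | label (R : σ)
  | comma
  | semicolon

section Encoding

variable {σ : Type}

/-- Natural numbers in binary, terminated by a comma. -/
def encodeNat (n : ℕ) : List (Symbol σ) :=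
  (Computability.encodeNat n).map Symbol.bit ++ [Symbol.comma]

/-- A fraction: numerator and denominator in binary. -/
def encodeFraction (q : ProbFraction) : List (Symbol σ) :=
  encodeNat q.num ++ encodeNat q.den

/-- A graph: the list of its vertices, then the list of its edges, each given by its source, its
target, its label and a further annotation (such as a probability). -/
def encodeGraph {n : ℕ} (G : LabeledGraph (Fin n) σ) (annot : G.edges → List (Symbol σ)) :
    List (Symbol σ) :=
  (List.finRange n).flatMap (fun v => encodeNat v) ++ [Symbol.semicolon] ++
    G.edgeList.flatMap (fun e =>
      encodeNat e.1.1 ++ encodeNat e.1.2 ++ [Symbol.label (G.label e)] ++ annot e) ++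
    [Symbol.semicolon]

/-- An input: the query graph, followed by the instance graph with the probabilities of its
edges. -/
def encodeInput {𝒢 ℋ : GraphClass σ} (x : Input 𝒢 ℋ) : List (Symbol σ) :=
  encodeGraph x.G (fun _ => []) ++ encodeGraph x.H (fun e => encodeFraction (x.prob e))

end Encoding

/-- The probabilistic homomorphism problem for query graphs in `𝒢` and instance graphs in `ℋ` is
in PTIME (in combined complexity): some deterministic Turing machine outputs, on every input, a
fraction that represents the probability `Pr(G ⇝ H)`, in time polynomial in the length of the
encoding of the whole input. -/
def InPTIME {σ : Type} (𝒢 ℋ : GraphClass σ) : Prop :=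
  ∃ f : Input 𝒢 ℋ → ProbFraction, (∀ x, (f x).toRat = x.answer) ∧
    Nonempty (Turing.TM2ComputableInPolyTime
      (encodeInput : Input 𝒢 ℋ → List (Symbol σ)) (encodeFraction : _ → List (Symbol σ)) f)

end PHom

/-! Number the edges of the path `H` from one end to the other. As `G` is connected, a homomorphism
to a subgraph of `H` uses every edge between the lowest and the highest position in its image. For
the suffix of `H` starting at position `i`, with all its edges present, let `r i` be the least `t`
such that `G` maps into the first `t` edges of that suffix. Then `G` maps to a possible world iff
for some `i` the `r i` edges from `i` on exist and are all kept (`homTo_subgraph_iff`).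

The number `r i` comes from a least homomorphism. Put every vertex of `G` at position 0 and
repeatedly advance each vertex that has no suitable neighbor at or beyond the position of one of its
partners. This never overtakes an actual homomorphism, and a state where nothing moves is itself a
homomorphism, because two adjacent vertices that both have such a neighbor are exactly one step
apart. Each round before stabilization increases the sum of the positions, so polynomially many
rounds decide the question (`reach_le_iff`).

Shifting a homomorphism by one gives `r (e :: L) ≤ r L + 1` (`reach_cons_le`). This makes a dynamic
program from the far end work. Let `X_k(L)` be the probability that the first `k` edges of the
suffix `L` are kept or that `L` contains a match, for `k ≤ r L`. Then `X_0 = 1`, the probability of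
a match in `L` is `N = X_{r L}(L)` (or 0 if `r L` exceeds the length), and `X_{k+1}(e :: L) = p *
X_k(L) + (1 - p) * N` with `p` the probability of `e`. The table stores numerators over a common
denominator, the product of the denominators so far, which is the entry for `k = 0` (`dp_spec`).
Their bit lengths stay linear in the size of the input (`dp_bounds`).

For the running time, data are binary trees, stored in prefix code on a stack of bits, and
`PolyTime` functions are those computed by structured programs over four such stacks. They are
closed under composition, pairing, case distinction and folds whose intermediate values have
polynomial size, which suffices for binary arithmetic, parsing and the algorithm above. Programs
compile to Turing machines step by step (`Run.steps`), and `PolyTime.exists_machine` adds the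
conversion of input and output. -/

namespace PHom

/-! ### A structured programming language over four stacks of bits -/

/-- The names of the four stacks of bits. -/
inductive Stk
  | S | A | B | C
  deriving DecidableEq

instance : Fintype Stk := ⟨{.S, .A, .B, .C}, fun k => by cases k <;> simp⟩

/-- The contents of the four stacks. -/
structure Store where
  S : List Bool
  A : List Bool
  B : List Bool
  C : List Bool

namespace Store

/-- The contents of a stack. -/
def get (s : Store) : Stk → List Bool
  | .S => s.S
  | .A => s.A
  | .B => s.B
  | .C => s.C

/-- Replace the contents of a stack. -/
def set (s : Store) : Stk → List Bool → Store
  | .S, l => { s with S := l }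
  | .A, l => { s with A := l }
  | .B, l => { s with B := l }
  | .C, l => { s with C := l }

/-- The total length of the stacks. -/
def length (s : Store) : ℕ := s.S.length + s.A.length + s.B.length + s.C.length

theorem get_set (s : Store) (k k' : Stk) (l : List Bool) :
    (s.set k l).get k' = if k' = k then l else s.get k' := by
  cases k <;> cases k' <;> rfl

theorem length_set (s : Store) (k : Stk) (l : List Bool) :
    (s.set k l).length + (s.get k).length = s.length + l.length := by
  cases k <;> simp only [length, set, get] <;> omega

end Store

/-- Structured programs over the four stacks. -/
inductive Code
  | skip
  | push (k : Stk) (b : Bool)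
  | pop (k : Stk) (onEmpty : Code) (on : Bool → Code)
  | seq (c d : Code)
  | loop (k : Stk) (p : Option Bool → Bool) (c : Code)

/-- `Run c s s' n`: started on `s`, the program `c` stops in `s'` after `n` steps. -/
inductive Run : Code → Store → Store → ℕ → Prop
  | skip (s) : Run .skip s s 0
  | push (k b s) : Run (.push k b) s (s.set k (b :: s.get k)) 1
  | pop_nil {k e on s s' n} : s.get k = [] → Run e s s' n → Run (.pop k e on) s s' (n + 1)
  | pop_cons {k e on s s' n b l} : s.get k = b :: l → Run (on b) (s.set k l) s' n →
      Run (.pop k e on) s s' (n + 1)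
  | seq {c d s s' s'' n m} : Run c s s' n → Run d s' s'' m → Run (.seq c d) s s'' (n + m)
  | loop_done {k p c s} : p (s.get k).head? = false → Run (.loop k p c) s s 1
  | loop_step {k p c s s' s'' n m} : p (s.get k).head? = true → Run c s s' n →
      Run (.loop k p c) s' s'' m → Run (.loop k p c) s s'' (n + m + 1)

/-- A step pushes at most one bit. Hence a time bound is also a bound on the size of the output,
which is what lets polynomial bounds compose. -/
theorem Run.length_le {c : Code} {s s' : Store} {n : ℕ} (h : Run c s s' n) :
    s'.length ≤ s.length + n := by
  induction h with
  | skip s => simp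
  | push k b s =>
    have := s.length_set k (b :: s.get k)
    simp only [List.length_cons] at this
    omega
  | pop_nil _ _ ih => omega
  | @pop_cons k e on s s' n b l h _ ih =>
    have := s.length_set k l
    rw [h] at this
    simp only [List.length_cons] at this
    omega
  | seq _ _ ih₁ ih₂ => omega
  | loop_done _ => omega
  | loop_step _ _ _ ih₁ ih₂ => omega

/-- Running a program with an upper bound on the number of steps. -/
def RunIn (c : Code) (s s' : Store) (N : ℕ) : Prop := ∃ n ≤ N, Run c s s' n

namespace RunIn

variable {c d : Code} {s s' s'' : Store} {n m : ℕ} {k : Stk}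

theorem mono (h : RunIn c s s' n) (hn : n ≤ m) : RunIn c s s' m :=
  let ⟨i, hi, r⟩ := h
  ⟨i, hi.trans hn, r⟩

theorem skip : RunIn .skip s s 0 := ⟨0, le_rfl, .skip s⟩

theorem push (b : Bool) (h : s' = s.set k (b :: s.get k)) : RunIn (.push k b) s s' 1 :=
  ⟨1, le_rfl, h ▸ .push k b s⟩

theorem pop_cons {on : Bool → Code} {b : Bool} {l : List Bool} (h : s.get k = b :: l)
    (r : RunIn (on b) (s.set k l) s' n) : RunIn (.pop k c on) s s' (n + 1) :=
  let ⟨_, hi, r⟩ := r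
  ⟨_, Nat.add_le_add_right hi 1, .pop_cons h r⟩

theorem seq (h₁ : RunIn c s s' n) (h₂ : RunIn d s' s'' m) : RunIn (.seq c d) s s'' (n + m) :=
  let ⟨_, hi, r₁⟩ := h₁
  let ⟨_, hj, r₂⟩ := h₂
  ⟨_, Nat.add_le_add hi hj, .seq r₁ r₂⟩

theorem loop_done {p : Option Bool → Bool} (h : p (s.get k).head? = false) :
    RunIn (.loop k p c) s s 1 := ⟨1, le_rfl, .loop_done h⟩

theorem loop_step {p : Option Bool → Bool} (h : p (s.get k).head? = true) (h₁ : RunIn c s s' n)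
    (h₂ : RunIn (.loop k p c) s' s'' m) : RunIn (.loop k p c) s s'' (n + m + 1) :=
  let ⟨_, hi, r₁⟩ := h₁
  let ⟨_, hj, r₂⟩ := h₂
  ⟨_, Nat.add_le_add_right (Nat.add_le_add hi hj) 1, .loop_step h r₁ r₂⟩

theorem length_le (h : RunIn c s s' n) : s'.length ≤ s.length + n :=
  let ⟨_, hi, r⟩ := h
  r.length_le.trans (by omega)

end RunIn

/-! ### Binary trees on the stack -/

/-- Binary trees, the universal data type of the programs. -/
inductive Val
  | nil
  | node (a b : Val)

namespace Val

/-- The prefix code of a binary tree. -/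
def ser : Val → List Bool
  | nil => [false]
  | node a b => true :: (a.ser ++ b.ser)

/-- The length of the prefix code of a tree. -/
def size (t : Val) : ℕ := t.ser.length

@[simp] theorem size_nil : nil.size = 1 := rfl

@[simp] theorem size_node (a b : Val) : (node a b).size = a.size + b.size + 1 := by
  simp [size, ser]

theorem one_le_size (t : Val) : 1 ≤ t.size := by cases t <;> simp

end Val

open Val

/-- The store with a value on top of the main stack, the other stacks being empty. -/
abbrev onTop (l : List Bool) : Store := ⟨l, [], [], []⟩

namespace Code

/-- The body of the loop that moves the prefix code of a tree off the main stack. -/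
def moveBody (k : Stk) : Code :=
  .pop .S .skip fun b => .seq (.push k b) <|
    bif b then .push .C true else .pop .C .skip fun _ => .skip

/-- The loop that moves the prefix code of a tree off the main stack. -/
def moveLoop (k : Stk) : Code := .loop .C Option.isSome (moveBody k)

/-- Move the topmost tree of the main stack to another stack, in reversed order. -/
def move (k : Stk) : Code := .seq (.push .C true) (moveLoop k)

/-- Move one stack to others. -/
def pour (k : Stk) (c : Bool → Code) : Code := .loop k Option.isSome (.pop k .skip c)

/-- Remove the topmost tree. -/
def drop : Code := .seq (move .A) (pour .A fun _ => .skip)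

/-- Duplicate the topmost tree. -/
def dup : Code :=
  .seq (move .A) <| .seq (pour .A fun b => .seq (.push .S b) (.push .B b)) <|
    .seq (pour .B fun b => .push .A b) (pour .A fun b => .push .S b)

/-- Exchange the two topmost trees. -/
def swap : Code :=
  .seq (move .A) <| .seq (move .B) <|
    .seq (pour .A fun b => .push .S b) (pour .B fun b => .push .S b)

/-- Push a list of bits on the main stack. -/
def pushList : List Bool → Code
  | [] => .skip
  | b :: l => .seq (pushList l) (.push .S b)

end Code

open Code

theorem runIn_pushList (l s : List Bool) : RunIn (pushList l) (onTop s)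
    (onTop (l ++ s)) l.length := by
  induction l with
  | nil => exact RunIn.skip
  | cons b l ih => exact ih.seq (RunIn.push b rfl)

/-- The stack `C` counts in unary the subtrees still to be moved: a leaf consumes one entry, an
inner node replaces one entry by two. The rest of the run is carried as a hypothesis so that the two
subtrees of a node can be chained in the induction. Each bit costs four steps. -/
theorem runIn_moveLoop_A (t : Val) {s a b c : List Bool} {s' : Store} {n : ℕ}
    (h : RunIn (moveLoop .A) ⟨s, t.ser.reverse ++ a, b, c⟩ s' n) :
    RunIn (moveLoop .A) ⟨t.ser ++ s, a, b, true :: c⟩ s' (4 * t.size + n) := by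
  induction t generalizing s a b c n with
  | nil =>
    refine (RunIn.loop_step (n := 3) rfl (RunIn.pop_cons (n := 2) rfl
      (RunIn.seq (n := 1) (RunIn.push false rfl) (RunIn.pop_cons (n := 0) rfl RunIn.skip))) h).mono
        ?_
    simp
  | node u v ihu ihv =>
    have h₂ := ihv (c := c) (a := u.ser.reverse ++ true :: a) (b := b) (s := s) (n := n)
      (by simpa [ser] using h)
    have h₁ := ihu h₂
    refine (RunIn.loop_step (n := 3) rfl (RunIn.pop_cons (n := 2) rfl
      (RunIn.seq (n := 1) (RunIn.push true rfl) (RunIn.push true rfl))) (m := _) ?_).mono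
        (n := 3 + (4 * u.size + (4 * v.size + n)) + 1) (by simp; omega)
    simpa [ser, Store.set, Store.get, moveLoop, moveBody] using h₁

theorem runIn_moveLoop_B (t : Val) {s a b c : List Bool} {s' : Store} {n : ℕ}
    (h : RunIn (moveLoop .B) ⟨s, a, t.ser.reverse ++ b, c⟩ s' n) :
    RunIn (moveLoop .B) ⟨t.ser ++ s, a, b, true :: c⟩ s' (4 * t.size + n) := by
  induction t generalizing s a b c n with
  | nil =>
    refine (RunIn.loop_step (n := 3) rfl (RunIn.pop_cons (n := 2) rfl
      (RunIn.seq (n := 1) (RunIn.push false rfl) (RunIn.pop_cons (n := 0) rfl RunIn.skip))) h).mono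
        ?_
    simp
  | node u v ihu ihv =>
    have h₂ := ihv (c := c) (b := u.ser.reverse ++ true :: b) (a := a) (s := s) (n := n)
      (by simpa [ser] using h)
    have h₁ := ihu h₂
    refine (RunIn.loop_step (n := 3) rfl (RunIn.pop_cons (n := 2) rfl
      (RunIn.seq (n := 1) (RunIn.push true rfl) (RunIn.push true rfl))) (m := _) ?_).mono
        (n := 3 + (4 * u.size + (4 * v.size + n)) + 1) (by simp; omega)
    simpa [ser, Store.set, Store.get, moveLoop, moveBody] using h₁

theorem runIn_move_A (t : Val) (s a b : List Bool) :
    RunIn (move .A) ⟨t.ser ++ s, a, b, []⟩ ⟨s, t.ser.reverse ++ a, b, []⟩ (4 * t.size + 2) :=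
  (RunIn.seq (RunIn.push true rfl) (runIn_moveLoop_A t (n := 1) (RunIn.loop_done rfl))).mono
    (by omega)

theorem runIn_move_B (t : Val) (s a b : List Bool) :
    RunIn (move .B) ⟨t.ser ++ s, a, b, []⟩ ⟨s, a, t.ser.reverse ++ b, []⟩ (4 * t.size + 2) :=
  (RunIn.seq (RunIn.push true rfl) (runIn_moveLoop_B t (n := 1) (RunIn.loop_done rfl))).mono
    (by omega)

theorem runIn_pour_A_skip (s a b c : List Bool) :
    RunIn (pour .A fun _ => .skip) ⟨s, a, b, c⟩ ⟨s, [], b, c⟩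
      (5 * a.length + 1) := by
  induction a generalizing s b with
  | nil => exact RunIn.loop_done rfl
  | cons x l ih =>
    refine ((RunIn.pop_cons rfl RunIn.skip).loop_step rfl ?_).mono
      (n := _ + (5 * l.length + 1) + 1) ?_
    · simpa [pour, Store.set, Store.get] using ih ..
    · simp only [List.length_cons]; omega

theorem runIn_pour_A_S (s a b c : List Bool) :
    RunIn (pour .A fun x => .push .S x) ⟨s, a, b, c⟩ ⟨a.reverse ++ s, [], b, c⟩
      (5 * a.length + 1) := by
  induction a generalizing s b with
  | nil => exact RunIn.loop_done rfl
  | cons x l ih =>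
    refine ((RunIn.pop_cons rfl (RunIn.push x rfl)).loop_step rfl ?_).mono
      (n := _ + (5 * l.length + 1) + 1) ?_
    · simpa [pour, Store.set, Store.get] using ih ..
    · simp only [List.length_cons]; omega

theorem runIn_pour_A_SB (s a b c : List Bool) :
    RunIn (pour .A fun x => .seq (.push .S x) (.push .B x)) ⟨s, a, b, c⟩
      ⟨a.reverse ++ s, [], a.reverse ++ b, c⟩
      (5 * a.length + 1) := by
  induction a generalizing s b with
  | nil => exact RunIn.loop_done rfl
  | cons x l ih =>
    refine ((RunIn.pop_cons rfl ((RunIn.push x rfl).seq (RunIn.push x rfl))).loop_step rfl ?_).mono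
      (n := _ + (5 * l.length + 1) + 1) ?_
    · simpa [pour, Store.set, Store.get] using ih ..
    · simp only [List.length_cons]; omega

theorem runIn_pour_B_A (s a b c : List Bool) :
    RunIn (pour .B fun x => .push .A x) ⟨s, a, b, c⟩ ⟨s, b.reverse ++ a, [], c⟩
      (5 * b.length + 1) := by
  induction b generalizing s a with
  | nil => exact RunIn.loop_done rfl
  | cons x l ih =>
    refine ((RunIn.pop_cons rfl (RunIn.push x rfl)).loop_step rfl ?_).mono
      (n := _ + (5 * l.length + 1) + 1) ?_
    · simpa [pour, Store.set, Store.get] using ih ..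
    · simp only [List.length_cons]; omega

theorem runIn_pour_B_S (s a b c : List Bool) :
    RunIn (pour .B fun x => .push .S x) ⟨s, a, b, c⟩ ⟨b.reverse ++ s, a, [], c⟩
      (5 * b.length + 1) := by
  induction b generalizing s a with
  | nil => exact RunIn.loop_done rfl
  | cons x l ih =>
    refine ((RunIn.pop_cons rfl (RunIn.push x rfl)).loop_step rfl ?_).mono
      (n := _ + (5 * l.length + 1) + 1) ?_
    · simpa [pour, Store.set, Store.get] using ih ..
    · simp only [List.length_cons]; omega

theorem runIn_drop (t : Val) (s : List Bool) :
    RunIn drop (onTop (t.ser ++ s)) (onTop s) (20 * t.size + 20) := by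
  refine ((runIn_move_A t s [] []).seq (runIn_pour_A_skip ..)).mono ?_
  simp [size]; omega

/-- Every transfer reverses the code: the two copies made from `A` are both in the original order,
and the one on `B` returns to the main stack by way of `A`, through two further reversals. -/
theorem runIn_dup (t : Val) (s : List Bool) :
    RunIn dup (onTop (t.ser ++ s)) (onTop (t.ser ++ (t.ser ++ s))) (20 * t.size + 20) := by
  have h := (runIn_move_A t s [] []).seq <| (runIn_pour_A_SB ..).seq <|
    (runIn_pour_B_A ..).seq (runIn_pour_A_S ..)
  simp only [List.append_nil, List.reverse_reverse] at h
  refine h.mono ?_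
  simp [size]; omega

theorem runIn_swap (t u : Val) (s : List Bool) :
    RunIn swap (onTop (t.ser ++ (u.ser ++ s))) (onTop (u.ser ++ (t.ser ++ s)))
      (20 * (t.size + u.size) + 20) := by
  have h := (runIn_move_A t (u.ser ++ s) [] []).seq <| (runIn_move_B u ..).seq <|
    (runIn_pour_A_S ..).seq (runIn_pour_B_S ..)
  simp only [List.append_nil, List.reverse_reverse] at h
  refine h.mono ?_
  simp [size]; omega

end PHom

namespace PHom

open Val Code

/-! ### Functions computable in polynomial time -/

theorem eval_mono (p : Polynomial ℕ) {m n : ℕ} (h : m ≤ n) : p.eval m ≤ p.eval n := by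
  simp only [Polynomial.eval_eq_sum, Polynomial.sum]
  gcongr

/-- Types whose elements are represented by binary trees. -/
class Enc (α : Type) where
  enc : α → Val

open Enc

/-- The size of the representation of `a`. -/
def sz {α : Type} [Enc α] (a : α) : ℕ := (enc a).size

/-- Both truth values have codes of five bits that differ first in the second bit, so a program can
branch on a Boolean and remove it with a fixed number of pops. -/
instance : Enc Bool := ⟨fun b => bif b then node (node nil nil) nil else node nil (node nil nil)⟩

instance {α β : Type} [Enc α] [Enc β] : Enc (α × β) := ⟨fun p => node (enc p.1) (enc p.2)⟩

/-- The representation of lists. -/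
def encList {α : Type} [Enc α] : List α → Val
  | [] => nil
  | a :: l => node (enc a) (encList l)

instance {α : Type} [Enc α] : Enc (List α) := ⟨encList⟩

instance : Enc ℕ := ⟨fun n => enc n.bits⟩

section

variable {α β γ δ : Type} [Enc α] [Enc β] [Enc γ] [Enc δ]

theorem one_le_sz (a : α) : 1 ≤ sz a := (enc a).one_le_size

@[simp] theorem sz_pair (a : α) (b : β) : sz (a, b) = sz a + sz b + 1 := by simp [sz, enc]

@[simp] theorem sz_nil : sz ([] : List α) = 1 := rfl

@[simp] theorem sz_cons (a : α) (l : List α) : sz (a :: l) = sz a + sz l + 1 := by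
  simp [sz, enc, encList]

@[simp] theorem sz_bool (b : Bool) : sz b = 5 := by cases b <;> simp [sz, enc]

theorem sz_append (l l' : List α) : sz (l ++ l') + 1 = sz l + sz l' := by
  induction l with
  | nil => simp; omega
  | cons a l ih => simp; omega

theorem sz_reverse (l : List α) : sz l.reverse = sz l := by
  induction l with
  | nil => simp
  | cons a l ih =>
    have := sz_append l.reverse [a]
    simp only [List.reverse_cons, sz_cons, sz_nil] at *
    omega

theorem length_le_sz (l : List α) : l.length ≤ sz l := by
  induction l with
  | nil => simp
  | cons a l ih => simp; omega

theorem sz_le_of_mem {l : List α} {a : α} (h : a ∈ l) : sz a ≤ sz l := by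
  induction h with
  | head => simp; omega
  | tail _ _ ih => simp; omega

theorem sz_le_of_sublist {l l' : List α} (h : l.Sublist l') : sz l ≤ sz l' := by
  induction h with
  | slnil => rfl
  | cons _ _ ih => simp; omega
  | cons_cons _ _ ih => simp; omega

theorem sz_list_le {l : List α} {n : ℕ} (h : ∀ a ∈ l, sz a ≤ n) :
    sz l ≤ l.length * (n + 1) + 1 := by
  induction l with
  | nil => simp
  | cons a l ih =>
    have h₁ := h a (by simp)
    have h₂ := ih fun b hb => h b (by simp [hb])
    simp only [sz_cons, List.length_cons, add_mul]
    omega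

/-- Some program computes `f` on the topmost value of the main stack, in polynomial time. -/
@[fun_prop]
def PolyTime (f : α → β) : Prop :=
  ∃ (c : Code) (p : Polynomial ℕ), ∀ (a : α) (s : List Bool),
    RunIn c (onTop ((enc a).ser ++ s)) (onTop ((enc (f a)).ser ++ s)) (p.eval (sz a))

theorem RunIn.popS {c : Code} {on : Bool → Code} {b : Bool} {l : List Bool} {s' : Store} {n : ℕ}
    (r : RunIn (on b) (onTop l) s' n) : RunIn (.pop .S c on) (onTop (b :: l)) s' (n + 1) :=
  RunIn.pop_cons rfl r

namespace PolyTime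

theorem exists_sz_le {f : α → β} (hf : PolyTime f) :
    ∃ p : Polynomial ℕ, ∀ a, sz (f a) ≤ p.eval (sz a) := by
  obtain ⟨c, p, h⟩ := hf
  refine ⟨.X + p, fun a => ?_⟩
  have := (h a []).length_le
  simpa [Store.length, sz, size] using this

/-- Computability depends only on the codes, so a program may be reused for another type: a nonempty
list is coded as a pair, a natural number as its list of bits. -/
theorem of_enc_eq {f : α → β} {f' : γ → δ} (hf : PolyTime f) (i : γ → α)
    (hi : ∀ c, enc (i c) = enc c) (h : ∀ c, enc (f (i c)) = enc (f' c)) : PolyTime f' := by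
  obtain ⟨c, p, hc⟩ := hf
  refine ⟨c, p, fun a s => ?_⟩
  have := hc (i a) s
  rwa [sz, h, hi] at this

@[fun_prop]
theorem id : PolyTime (fun a : α => a) := ⟨.skip, 0, fun _ _ => RunIn.skip.mono (by simp)⟩

@[fun_prop]
theorem comp {f : β → γ} {g : α → β} (hf : PolyTime f) (hg : PolyTime g) :
    PolyTime (fun a => f (g a)) := by
  obtain ⟨q, hq⟩ := hg.exists_sz_le
  obtain ⟨c, p, hc⟩ := hf
  obtain ⟨d, r, hd⟩ := hg
  refine ⟨.seq d c, r + p.comp q, fun a s => ((hd a s).seq (hc (g a) s)).mono ?_⟩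
  simpa using eval_mono p (hq a)

@[fun_prop]
theorem const (b : β) : PolyTime (fun _ : α => b) :=
  ⟨.seq drop (pushList (enc b).ser), 20 * .X + 20 + .C (sz b), fun a s =>
    ((runIn_drop _ s).seq (runIn_pushList _ s)).mono (by simp [sz, size])⟩

@[fun_prop]
theorem pair {f : α → β} {g : α → γ} (hf : PolyTime f) (hg : PolyTime g) :
    PolyTime (fun a => (f a, g a)) := by
  obtain ⟨q, hq⟩ := hf.exists_sz_le
  obtain ⟨q', hq'⟩ := hg.exists_sz_le
  obtain ⟨c, p, hc⟩ := hf
  obtain ⟨d, r, hd⟩ := hg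
  refine ⟨.seq dup <| .seq c <| .seq swap <| .seq d <| .seq swap (.push .S true),
    (20 * .X + 20) + (p + ((20 * (q + .X) + 20) + (r + ((20 * (q' + q) + 20) + 1)))), fun a s =>
    ((runIn_dup _ s).seq <| (hc _ _).seq <| (runIn_swap _ _ _).seq <| (hd _ _).seq <|
      (runIn_swap _ _ _).seq <| RunIn.push true (by simp [Store.set, Store.get, enc, ser])).mono ?_⟩
  have h₁ := hq a
  have h₂ := hq' a
  simp only [sz] at *
  simp
  omega

theorem fst_aux : PolyTime (fun p : α × β => p.1) :=
  ⟨.pop .S .skip fun _ => .seq swap drop, 40 * .X + 100, fun ⟨a, b⟩ s => by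
    refine (RunIn.pop_cons (b := true) (l := (enc a).ser ++ ((enc b).ser ++ s)) ?_
      ((runIn_swap _ _ s).seq (runIn_drop _ _))).mono ?_
    · simp [Store.get, enc, ser]
    · simp [sz, enc]; omega⟩

theorem snd_aux : PolyTime (fun p : α × β => p.2) :=
  ⟨.pop .S .skip fun _ => drop, 40 * .X + 100, fun ⟨a, b⟩ s => by
    refine (RunIn.pop_cons (b := true) (l := (enc a).ser ++ ((enc b).ser ++ s)) ?_
      (runIn_drop _ _)).mono ?_
    · simp [Store.get, enc, ser]
    · simp [sz, enc]; omega⟩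

@[fun_prop]
theorem fst {f : α → β × γ} (hf : PolyTime f) : PolyTime (fun a => (f a).1) := fst_aux.comp hf

@[fun_prop]
theorem snd {f : α → β × γ} (hf : PolyTime f) : PolyTime (fun a => (f a).2) := snd_aux.comp hf

@[fun_prop]
theorem cons {f : α → β} {g : α → List β} (hf : PolyTime f) (hg : PolyTime g) :
    PolyTime (fun a => f a :: g a) :=
  (hf.pair hg).of_enc_eq (fun a => a) (fun _ => rfl) fun _ => rfl

@[fun_prop]
theorem cond {b : α → Bool} {f g : α → β} (hb : PolyTime b) (hf : PolyTime f) (hg : PolyTime g) :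
    PolyTime (fun a => bif b a then f a else g a) := by
  obtain ⟨q, hq⟩ := (hb.pair id).exists_sz_le
  obtain ⟨e, t, he⟩ := hb.pair id
  obtain ⟨c, p, hc⟩ := hf
  obtain ⟨d, r, hd⟩ := hg
  -- The first bit popped is the root of the pair; the next five are the Boolean, of which the
  -- second, that is the third pop, decides. The saved copy of the argument is then on top for the
  -- chosen branch.
  refine ⟨.seq e <| .pop .S .skip fun _ => .pop .S .skip fun _ => .pop .S .skip fun x =>
    .pop .S .skip fun _ => .pop .S .skip fun _ => .pop .S .skip fun _ => bif x then c else d,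
      t + (p + r + 6),
      fun a s => ((he a s).seq (RunIn.pop_cons (b := true) 
        (l := (enc (b a)).ser ++ ((enc a).ser ++ s)) (n := p.eval (sz a) + r.eval (sz a) + 5) ?_ ?_)).mono
          ?_⟩
  · simp [Store.get, enc, ser]
  · change RunIn _ (onTop ((enc (b a)).ser ++ ((enc a).ser ++ s)))
      (onTop ((enc (bif b a then f a else g a)).ser ++ s)) _
    cases b a
    · exact (RunIn.popS (RunIn.popS (RunIn.popS (RunIn.popS (RunIn.popS (hd a s)))))).mono
        (n := r.eval (sz a) + 1 + 1 + 1 + 1 + 1) (by omega)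
    · exact (RunIn.popS (RunIn.popS (RunIn.popS (RunIn.popS (RunIn.popS (hc a s)))))).mono
        (n := p.eval (sz a) + 1 + 1 + 1 + 1 + 1) (by omega)
  · simp

@[fun_prop]
theorem tail {f : α → List β} (hf : PolyTime f) : PolyTime (fun a => (f a).tail) := by
  refine comp (f := List.tail) ⟨.pop .S .skip fun x => bif x then drop else .push .S false,
    20 * .X + 30, fun l s => ?_⟩ hf
  cases l with
  | nil =>
    refine RunIn.mono (n := 2) (RunIn.popS (RunIn.push false rfl)) ?_
    simp
  | cons a l =>
    refine (RunIn.pop_cons (b := true) (l := (enc a).ser ++ ((enc l).ser ++ s)) ?_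
      (runIn_drop _ _)).mono ?_
    · simp [Store.get, enc, ser, encList]
    · simp [sz, enc, encList]; omega

@[fun_prop]
theorem headD {f : α → List β} (hf : PolyTime f) (b : β) : PolyTime (fun a => (f a).headD b) := by
  refine comp (f := fun l : List β => l.headD b)
    ⟨.pop .S .skip fun x => bif x then .seq swap drop else
    pushList (enc b).ser, 40 * .X + 50 + .C (sz b), fun l s => ?_⟩ hf
  cases l with
  | nil =>
    exact (RunIn.popS (runIn_pushList _ _)).mono (n := (enc b).ser.length + 1)
      (by simp [sz, size])
  | cons a l =>
    refine (RunIn.pop_cons (b := true) (l := (enc a).ser ++ ((enc l).ser ++ s)) ?_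
      ((runIn_swap _ _ s).seq (runIn_drop _ _))).mono ?_
    · simp [Store.get, enc, ser, encList]
    · simp [sz, enc, encList]; omega

@[fun_prop]
theorem isEmpty {f : α → List β} (hf : PolyTime f) : PolyTime (fun a => (f a).isEmpty) := by
  refine comp (f := List.isEmpty) ⟨.pop .S .skip fun x => bif x then .seq drop (.seq drop
    (pushList (enc false).ser)) else pushList (enc true).ser, 40 * .X + 50, fun l s => ?_⟩ hf
  cases l with
  | nil =>
    exact (RunIn.popS (runIn_pushList _ _)).mono (n := 6) (by simp)
  | cons a l =>
    refine (RunIn.pop_cons (b := true) (l := (enc a).ser ++ ((enc l).ser ++ s)) ?_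
      ((runIn_drop _ _).seq ((runIn_drop _ _).seq (runIn_pushList _ _)))).mono ?_
    · simp [Store.get, enc, ser, encList]
    · simp [sz, enc, encList, ser]; omega

end PolyTime

/-! ### Folds with accumulators of polynomial size -/

/-- The loop that applies the body `g` until the list on top of the stack is empty. -/
def foldLoop (g : Code) : Code :=
  .loop .S (· == some true) (.seq (.push .S true) (.seq g (.pop .S .skip fun _ => .skip)))

/-- A nonempty list has the code of the pair of its head and tail, so pushing a single `true` joins
it with the pair below into an argument for `g`. Popping the root of the result leaves the tail
above the updated pair, ready for the next round. -/
theorem runIn_foldLoop {f : α → β → γ → β} {g : Code} {p : Polynomial ℕ}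
    (hg : ∀ (q : (γ × List γ) × (α × β)) (s : List Bool), RunIn g (onTop ((enc q).ser ++ s))
      (onTop ((enc (q.1.2, (q.2.1, f q.2.1 q.2.2 q.1.1))).ser ++ s)) (p.eval (sz q)))
    (a : α) (s : List Bool) (m M : ℕ) (l : List γ) (b : β) (hl : sz l ≤ m)
    (hM : ∀ l', l' <+: l → sz (l'.foldl (f a) b) ≤ M) :
    RunIn (foldLoop g) (onTop ((enc l).ser ++ ((enc (a, b)).ser ++ s)))
      (onTop (false :: ((enc (a, l.foldl (f a) b)).ser ++ s)))
      (l.length * (p.eval (m + sz a + M + 2) + 3) + 1) := by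
  induction l generalizing b with
  | nil => exact (RunIn.loop_done rfl).mono (by simp)
  | cons c l ih =>
    have h₁ := ih (f a b c) (by simp at hl; omega) fun l' hl' => hM (c :: l') (by simpa using hl')
    have h₂ := hg ((c, l), (a, b)) s
    have hb := hM [] (List.nil_prefix)
    refine (RunIn.loop_step rfl ((RunIn.push true rfl).seq (RunIn.seq (n := _) (m := 1) ?_
      (RunIn.popS (b := true)
        (n := 0) RunIn.skip))) h₁).mono
        (n := 1 + (p.eval (m + sz a + M + 2) + 1) + _ + 1) ?_
    · refine RunIn.mono (n := p.eval (sz ((c, l), (a, b)))) ?_ (eval_mono p ?_)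
      · convert h₂ using 2 <;> simp [Store.set, Store.get, enc, ser, encList]
      · simp at *; omega
    · simp only [List.length_cons, add_mul]; omega

namespace PolyTime

/-- Computability of folds whose intermediate values have polynomial size. -/
theorem foldl_of_bound {l : α → List γ} {b : α → β} {f : α → β → γ → β} (hl : PolyTime l)
    (hb : PolyTime b) (hf : PolyTime (fun q : α × β × γ => f q.1 q.2.1 q.2.2)) (B : Polynomial ℕ)
    (hB : ∀ a l', l' <+: l a → sz (l'.foldl (f a) (b a)) ≤ B.eval (sz a)) :
    PolyTime (fun a => (l a).foldl (f a) (b a)) := by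
  have hg : PolyTime (fun q : (γ × List γ) × (α × β) => (q.1.2, (q.2.1, f q.2.1 q.2.2 q.1.1))) := by
    have : PolyTime (fun q : (γ × List γ) × (α × β) => f q.2.1 q.2.2 q.1.1) :=
      hf.comp (g := fun q : (γ × List γ) × (α × β) => (q.2.1, q.2.2, q.1.1)) (by fun_prop)
    fun_prop
  obtain ⟨g, p, hg⟩ := hg
  obtain ⟨q, hq⟩ := hl.exists_sz_le
  have h₀ : PolyTime (fun a => (l a, (a, b a))) := by fun_prop
  obtain ⟨c, r, hc⟩ := h₀
  refine snd (f := fun a => (a, (l a).foldl (f a) (b a)))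
    ⟨.seq c (.pop .S .skip fun _ => .seq (foldLoop g) (.pop .S .skip fun _ => .skip)),
    r + (q * (p.comp (q + .X + B + 2) + 3) + 3), fun a s => ?_⟩
  refine ((hc a s).seq (RunIn.pop_cons (b := true)
    (l := (enc (l a)).ser ++ ((enc (a, b a)).ser ++ s)) ?_ ((runIn_foldLoop hg a s (sz (l a))
      (B.eval (sz a)) (l a) (b a) le_rfl (hB a)).seq (RunIn.pop_cons (n := 0) rfl RunIn.skip)))).mono
        ?_
  · simp [Store.get, enc, ser]
  · have h₁ : p.eval (sz (l a) + sz a + B.eval (sz a) + 2)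
      ≤ p.eval (q.eval (sz a) + sz a + B.eval (sz a) + 2) := eval_mono p (by have := hq a; omega)
    have h₂ := Nat.mul_le_mul ((length_le_sz (l a)).trans (hq a)) (Nat.add_le_add_right h₁ 3)
    simp
    omega

/-- Computability of folds with steps that increase the size by an amount that does not depend on
the state. -/
theorem foldl {l : α → List γ} {b : α → β} {f : α → β → γ → β} (hl : PolyTime l)
    (hb : PolyTime b) (hf : PolyTime (fun q : α × β × γ => f q.1 q.2.1 q.2.2)) (B : Polynomial ℕ)
    (hB : ∀ a b c, sz (f a b c) ≤ sz b + B.eval (sz a + sz c)) :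
    PolyTime (fun a => (l a).foldl (f a) (b a)) := by
  obtain ⟨q, hq⟩ := hl.exists_sz_le
  obtain ⟨r, hr⟩ := hb.exists_sz_le
  refine foldl_of_bound hl hb hf (r + q * B.comp (.X + q)) fun a l' hl' => ?_
  have key : ∀ (l' : List γ) (M : ℕ) (b : β), (∀ c ∈ l', sz c ≤ M) →
      sz (l'.foldl (f a) b) ≤ sz b + l'.length * B.eval (sz a + M) := by
    intro l' M
    induction l' with
    | nil => simp
    | cons c l' ih =>
      intro b hM
      have h₁ := ih (f a b c) fun c hc => hM c (by simp [hc])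
      have h₂ := hB a b c
      have h₃ : B.eval (sz a + sz c) ≤ B.eval (sz a + M) :=
        eval_mono B (by have := hM c (by simp); omega)
      simp only [List.foldl_cons, List.length_cons, add_mul]
      omega
  have h₁ := key l' (sz (l a)) (b a) fun c hc => sz_le_of_mem (hl'.subset hc)
  have h₂ : B.eval (sz a + sz (l a)) ≤ B.eval (sz a + q.eval (sz a)) :=
    eval_mono B (by have := hq a; omega)
  have h₃ := Nat.mul_le_mul ((hl'.length_le.trans (length_le_sz (l a))).trans (hq a)) h₂
  have h₄ := hr a
  simp
  omega

end PolyTime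

end

end PHom

namespace PHom

open Val Code
open Enc

section

variable {α β γ δ : Type} [Enc α] [Enc β] [Enc γ] [Enc δ]

namespace PolyTime

/-! ### Lists -/

theorem of_eq {f g : α → β} (hf : PolyTime f) (h : ∀ a, f a = g a) : PolyTime g := funext h ▸ hf

@[fun_prop]
theorem reverse {f : α → List β} (hf : PolyTime f) : PolyTime (fun a => (f a).reverse) :=
  (foldl (f := fun _ acc x => x :: acc) hf (const []) (by fun_prop) (.X + 1)
    (by intros; simp; omega)).of_eq fun a => by simp

@[fun_prop]
theorem append {f g : α → List β} (hf : PolyTime f) (hg : PolyTime g) :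
    PolyTime (fun a => f a ++ g a) :=
  (foldl (f := fun _ acc x => x :: acc) hf.reverse hg (by fun_prop) (.X + 1)
    (by intros; simp; omega)).of_eq fun a => by simp

theorem map {l : α → List β} {f : α → β → γ} (hl : PolyTime l)
    (hf : PolyTime (fun q : α × β => f q.1 q.2)) : PolyTime (fun a => (l a).map (f a)) := by
  obtain ⟨p, hp⟩ := hf.exists_sz_le
  have h : PolyTime (fun q : α × List γ × β => f q.1 q.2.2) :=
    hf.comp (g := fun q : α × List γ × β => (q.1, q.2.2)) (by fun_prop)
  refine (foldl (f := fun a acc x => f a x :: acc) hl (const []) (by fun_prop) (p.comp (.X + 1) + 1)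
    fun a b c => ?_).reverse.of_eq fun a => ?_
  · have := hp (a, c)
    simp at this ⊢
    omega
  · simp

theorem flatMap {l : α → List β} {f : α → β → List γ} (hl : PolyTime l)
    (hf : PolyTime (fun q : α × β => f q.1 q.2)) : PolyTime (fun a => (l a).flatMap (f a)) := by
  obtain ⟨p, hp⟩ := hf.exists_sz_le
  have h : PolyTime (fun q : α × List γ × β => f q.1 q.2.2) :=
    hf.comp (g := fun q : α × List γ × β => (q.1, q.2.2)) (by fun_prop)
  refine (foldl (f := fun a acc x => acc ++ f a x) hl (const []) (by fun_prop) (p.comp (.X + 1) + 1)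
    fun a b c => ?_).of_eq fun a => ?_
  · have := hp (a, c)
    have := sz_append b (f a c)
    simp at *
    omega
  · simp [List.flatMap_eq_foldl]

@[fun_prop]
theorem or {f g : α → Bool} (hf : PolyTime f) (hg : PolyTime g) : PolyTime (fun a => f a || g a) :=
  (hf.cond (const true) hg).of_eq fun a => by cases f a <;> rfl

@[fun_prop]
theorem and {f g : α → Bool} (hf : PolyTime f) (hg : PolyTime g) : PolyTime (fun a => f a && g a) :=
  (hf.cond hg (const false)).of_eq fun a => by cases f a <;> rfl

@[fun_prop]
theorem not {f : α → Bool} (hf : PolyTime f) : PolyTime (fun a => !f a) :=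
  (hf.cond (const false) (const true)).of_eq fun a => by cases f a <;> rfl

theorem bool₃ (o : Bool → Bool → Bool → Bool) {f g h : α → Bool} (hf : PolyTime f)
    (hg : PolyTime g) (hh : PolyTime h) : PolyTime (fun a => o (f a) (g a) (h a)) :=
  (hf.cond (hg.cond (hh.cond (const (o true true true)) (const (o true true false)))
    (hh.cond (const (o true false true)) (const (o true false false))))
    (hg.cond (hh.cond (const (o false true true)) (const (o false true false)))
    (hh.cond (const (o false false true)) (const (o false false false))))).of_eq fun a => by
      cases f a <;> cases g a <;> cases h a <;> rfl

theorem filter {l : α → List β} {f : α → β → Bool} (hl : PolyTime l)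
    (hf : PolyTime (fun q : α × β => f q.1 q.2)) : PolyTime (fun a => (l a).filter (f a)) := by
  refine (flatMap (f := fun a x => bif f a x then [x] else []) hl (by fun_prop)).of_eq fun a => ?_
  induction l a with
  | nil => rfl
  | cons x l ih => cases h : f a x <;> simp_all

theorem any {l : α → List β} {f : α → β → Bool} (hl : PolyTime l)
    (hf : PolyTime (fun q : α × β => f q.1 q.2)) : PolyTime (fun a => (l a).any (f a)) := by
  refine ((hl.filter hf).isEmpty.not).of_eq fun a => ?_
  rw [Bool.eq_iff_iff]
  simp

/-! ### Arithmetic in binary -/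

@[fun_prop]
theorem bits {f : α → ℕ} (hf : PolyTime f) : PolyTime (fun a => (f a).bits) :=
  hf.of_enc_eq (fun a => a) (fun _ => rfl) fun _ => rfl

@[fun_prop]
theorem half {f : α → ℕ} (hf : PolyTime f) : PolyTime (fun a => f a / 2) :=
  hf.bits.tail.of_enc_eq (fun a => a) (fun _ => rfl) fun a => by
    rw [← Nat.div2_bits_eq_tail]; rfl

@[fun_prop]
theorem bodd {f : α → ℕ} (hf : PolyTime f) : PolyTime (fun a => (f a).bodd) :=
  (hf.bits.headD false).of_eq fun a => by
    rw [Nat.bodd_eq_bits_head]; cases (f a).bits <;> rfl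

@[fun_prop]
theorem bit {f : α → ℕ} {b : α → Bool} (hf : PolyTime f) (hb : PolyTime b) :
    PolyTime (fun a => Nat.bit (b a) (f a)) := by
  -- The binary expansion has no leading zero, so appending the digit 0 to the number 0 must give
  -- the empty list.
  have h : PolyTime fun a => bif !(b a) && (f a).bits.isEmpty then [] else b a :: (f a).bits := by
    fun_prop
  refine h.of_enc_eq (fun a => a) (fun _ => rfl) fun a => ?_
  change _ = enc (Nat.bits _)
  congr 1
  by_cases h : f a = 0
  · cases hb : b a <;> simp [h]
  · rw [Nat.bits_append_bit _ _ fun h' => absurd h' h]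
    have : (f a).bits ≠ [] := by
      rw [ne_eq, ← List.length_eq_zero_iff, Nat.size_eq_bits_len, Nat.size_eq_zero]
      exact h
    rw [List.isEmpty_eq_false_iff.2 this]
    simp

end PolyTime

theorem sz_nat (n : ℕ) : sz n = 6 * n.size + 1 := by
  change sz n.bits = _
  rw [← Nat.size_eq_bits_len]
  induction n.bits with
  | nil => rfl
  | cons b l ih => simp [ih]; omega

theorem sz_nat_mono {m n : ℕ} (h : m ≤ n) : sz m ≤ sz n := by
  have := Nat.size_le_size h
  simp only [sz_nat]
  omega

theorem sz_nat_le {m k : ℕ} (h : m < 2 ^ k) : sz m ≤ 6 * k + 1 := by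
  have := Nat.size_le.2 h
  simp only [sz_nat]
  omega

theorem sz_add_le (m n : ℕ) : sz (m + n) ≤ max (sz m) (sz n) + 6 := by
  have h : m + n < 2 ^ (max m.size n.size + 1) := by
    have h₁ := (Nat.lt_size_self m).trans_le
      (Nat.pow_le_pow_right two_pos (le_max_left m.size n.size))
    have h₂ := (Nat.lt_size_self n).trans_le
      (Nat.pow_le_pow_right two_pos (le_max_right m.size n.size))
    rw [pow_succ]
    omega
  have := sz_nat_le h
  simp only [sz_nat] at *
  omega

theorem sz_bit_le (b : Bool) (n : ℕ) : sz (Nat.bit b n) ≤ sz n + 6 := by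
  have h : Nat.bit b n < 2 ^ (n.size + 1) := by
    have := Nat.lt_size_self n
    rw [pow_succ, Nat.bit_val]
    cases b <;> simp <;> omega
  have := sz_nat_le h
  simp only [sz_nat] at *
  omega

/-- Bitwise operations with a carry: `l.length` steps of the computation with digits `o` and
carries `r`, the digits of the result being listed from the most significant one on. -/
def ripple (o r : Bool → Bool → Bool → Bool) (l : List Bool) (s : (ℕ × ℕ) × Bool × List Bool) :
    (ℕ × ℕ) × Bool × List Bool :=
  l.foldl (fun s _ => ((s.1.1 / 2, s.1.2 / 2), r s.1.1.bodd s.1.2.bodd s.2.1,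
    o s.1.1.bodd s.1.2.bodd s.2.1 :: s.2.2)) s

theorem ripple_fst (o r : Bool → Bool → Bool → Bool) (l : List Bool)
    (s : (ℕ × ℕ) × Bool × List Bool) :
    (ripple o r l s).1 = (s.1.1 / 2 ^ l.length, s.1.2 / 2 ^ l.length) := by
  induction l generalizing s with
  | nil => simp [ripple]
  | cons b l ih =>
    rw [ripple, List.foldl_cons]
    refine (ih _).trans ?_
    simp [Nat.div_div_eq_div_mul, pow_succ, mul_comm]

/-- Here `v m n c` is the value still to be produced from the unread parts `m`, `n` and the carry
`c`, and `hv` says that one round splits off its last digit. Placing the digits found so far after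
this value, by Horner's rule over the integers, therefore gives an invariant. Integers allow the
same argument for subtraction, where `v` may be negative. -/
theorem ripple_inv (o r : Bool → Bool → Bool → Bool) (l : List Bool)
    (v : ℕ → ℕ → Bool → ℤ)
    (hv : ∀ m n c, 2 * v (m / 2) (n / 2) (r m.bodd n.bodd c) + (o m.bodd n.bodd c).toNat = v m n c)
    (s : (ℕ × ℕ) × Bool × List Bool) :
    (ripple o r l s).2.2.foldl (fun (z : ℤ) b => 2 * z + b.toNat)
      (v (ripple o r l s).1.1 (ripple o r l s).1.2 (ripple o r l s).2.1) =
    s.2.2.foldl (fun (z : ℤ) b => 2 * z + b.toNat) (v s.1.1 s.1.2 s.2.1) := by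
  induction l generalizing s with
  | nil => rfl
  | cons b l ih =>
    rw [ripple, List.foldl_cons]
    refine (ih _).trans ?_
    simp [hv]

theorem ripple_result (o r : Bool → Bool → Bool → Bool) (m n : ℕ)
    (v : ℕ → ℕ → Bool → ℤ)
    (hv : ∀ m n c, 2 * v (m / 2) (n / 2) (r m.bodd n.bodd c) + (o m.bodd n.bodd c).toNat =
      v m n c) :
    (ripple o r (m.bits ++ n.bits) ((m, n), false, [])).2.2.foldl (fun (z : ℤ) b => 2 * z + b.toNat)
      (v 0 0 (ripple o r (m.bits ++ n.bits) ((m, n), false, [])).2.1) = v m n false := by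
  have h := ripple_inv o r (m.bits ++ n.bits) v hv ((m, n), false, [])
  -- The number of rounds is the sum of both bit lengths, enough to exhaust either number.
  have h₁ : m / 2 ^ (m.bits ++ n.bits).length = 0 := by
    refine Nat.div_eq_of_lt ((Nat.lt_size_self m).trans_le (Nat.pow_le_pow_right two_pos ?_))
    simp [Nat.size_eq_bits_len]
  have h₂ : n / 2 ^ (m.bits ++ n.bits).length = 0 := by
    refine Nat.div_eq_of_lt ((Nat.lt_size_self n).trans_le (Nat.pow_le_pow_right two_pos ?_))
    simp [Nat.size_eq_bits_len]
  rw [ripple_fst] at h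
  dsimp only at h
  rw [h₁, h₂] at h
  simpa using h

theorem foldl_bit_cast (l : List Bool) (n : ℕ) :
    ((l.foldl (fun n b => Nat.bit b n) n : ℕ) : ℤ) =
      l.foldl (fun (z : ℤ) b => 2 * z + b.toNat) n := by
  induction l generalizing n with
  | nil => rfl
  | cons b l ih => rw [List.foldl_cons, ih]; simp [Nat.bit_val]

theorem foldl_bit_neg (l : List Bool) (z : ℤ) (hz : z < 0) :
    l.foldl (fun (z : ℤ) b => 2 * z + b.toNat) z < 0 := by
  induction l generalizing z with
  | nil => exact hz
  | cons b l ih => exact ih _ (by cases b <;> simp <;> omega)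

/-- Digits and carries of addition. -/
def addDigit (a b c : Bool) : Bool := xor (xor a b) c

/-- Carries of addition. -/
def addCarry (a b c : Bool) : Bool := a && b || a && c || b && c

/-- Borrows of subtraction. -/
def subCarry (a b c : Bool) : Bool := !a && b || !a && c || b && c

theorem add_eq_ripple (m n : ℕ) :
    (ripple addDigit addCarry (m.bits ++ n.bits) ((m, n), false, [])).2.2.foldl
      (fun n b => Nat.bit b n)
      (bif (ripple addDigit addCarry (m.bits ++ n.bits) ((m, n), false, [])).2.1 then 1 else 0) =
    m + n := by
  have h := ripple_result addDigit addCarry m n (fun m n c => m + n + c.toNat) fun m n c => by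
    have h₁ := Nat.bodd_add_div2 m
    have h₂ := Nat.bodd_add_div2 n
    rw [Nat.div2_val] at h₁ h₂
    revert h₁ h₂
    cases m.bodd <;> cases n.bodd <;> cases c <;> simp [addDigit, addCarry] <;> omega
  zify
  rw [foldl_bit_cast]
  simp only [Bool.toNat_false, Nat.cast_zero, add_zero] at h
  rw [← h]
  congr 1
  cases (ripple addDigit addCarry (m.bits ++ n.bits) ((m, n), false, [])).2.1 <;> simp

theorem sub_eq_ripple (m n : ℕ) :
    (bif (ripple addDigit subCarry (m.bits ++ n.bits) ((m, n), false, [])).2.1 then 0 else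
    (ripple addDigit subCarry (m.bits ++ n.bits) ((m, n), false, [])).2.2.foldl
      (fun n b => Nat.bit b n) 0) = m - n := by
  have h := ripple_result addDigit subCarry m n (fun m n c => m - n - c.toNat) fun m n c => by
    have h₁ := Nat.bodd_add_div2 m
    have h₂ := Nat.bodd_add_div2 n
    rw [Nat.div2_val] at h₁ h₂
    revert h₁ h₂
    cases m.bodd <;> cases n.bodd <;> cases c <;> simp [addDigit, subCarry] <;> omega
  -- A final borrow means that the integer difference is negative, so the truncated difference is 0.
  cases hc : (ripple addDigit subCarry (m.bits ++ n.bits) ((m, n), false, [])).2.1 with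
  | true =>
    rw [hc] at h
    have := foldl_bit_neg (ripple addDigit subCarry (m.bits ++ n.bits) ((m, n), false, [])).2.2
      (-1) (by norm_num)
    simp at h ⊢
    omega
  | false =>
    rw [hc] at h
    have := foldl_bit_cast (ripple addDigit subCarry (m.bits ++ n.bits) ((m, n), false, [])).2.2 0
    simp at h this ⊢
    omega

namespace PolyTime

theorem ripple (o r : Bool → Bool → Bool → Bool) {l : α → List Bool}
    {s : α → (ℕ × ℕ) × Bool × List Bool} (hl : PolyTime l) (hs : PolyTime s) :
    PolyTime (fun a => ripple o r (l a) (s a)) := by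
  have h (o : Bool → Bool → Bool → Bool) : PolyTime
      fun q : α × ((ℕ × ℕ) × Bool × List Bool) × Bool =>
        o q.2.1.1.1.bodd q.2.1.1.2.bodd q.2.1.2.1 :=
    bool₃ o (by fun_prop) (by fun_prop) (by fun_prop)
  have h₁ := h o
  have h₂ := h r
  refine foldl (f := fun _ (s : (ℕ × ℕ) × Bool × List Bool) _ => ((s.1.1 / 2, s.1.2 / 2),
    r s.1.1.bodd s.1.2.bodd s.2.1, o s.1.1.bodd s.1.2.bodd s.2.1 :: s.2.2)) hl hs
    (pair (by fun_prop) (h₂.pair (h₁.cons (by fun_prop)))) 6 fun a s _ => ?_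
  obtain ⟨⟨m, n⟩, c, t⟩ := s
  have h₁ := sz_nat_mono (Nat.div_le_self m 2)
  have h₂ := sz_nat_mono (Nat.div_le_self n 2)
  simp
  omega

theorem foldl_bit {l : α → List Bool} {n : α → ℕ} (hl : PolyTime l) (hn : PolyTime n) :
    PolyTime (fun a => (l a).foldl (fun n b => Nat.bit b n) (n a)) :=
  foldl (f := fun _ n b => Nat.bit b n) hl hn (by fun_prop) 6 fun _ n b =>
    by simpa using sz_bit_le b n

@[fun_prop]
theorem add {f g : α → ℕ} (hf : PolyTime f) (hg : PolyTime g) : PolyTime (fun a => f a + g a) := by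
  have h := ripple addDigit addCarry (l := fun a => (f a).bits ++ (g a).bits)
    (s := fun a => ((f a, g a), false, [])) (by fun_prop) (by fun_prop)
  exact (foldl_bit h.snd.snd (h.snd.fst.cond (const 1) (const 0))).of_eq fun a => add_eq_ripple _ _

@[fun_prop]
theorem sub {f g : α → ℕ} (hf : PolyTime f) (hg : PolyTime g) : PolyTime (fun a => f a - g a) := by
  have h := ripple addDigit subCarry (l := fun a => (f a).bits ++ (g a).bits)
    (s := fun a => ((f a, g a), false, [])) (by fun_prop) (by fun_prop)
  exact (h.snd.fst.cond (const 0) (foldl_bit h.snd.snd (const 0))).of_eq fun a => sub_eq_ripple _ _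

@[fun_prop]
theorem mul {f g : α → ℕ} (hf : PolyTime f) (hg : PolyTime g) : PolyTime (fun a => f a * g a) := by
  obtain ⟨r, hr⟩ := hf.exists_sz_le
  -- Horner's rule from the most significant bit. Doubling and adding cost at most six units of size
  -- each, beyond the size of the factor `f a`.
  refine (foldl (l := fun q : α => (g q).bits.reverse)
    (f := fun a n b => Nat.bit false n + bif b then f a else 0) (by fun_prop) (const 0)
    ?_ (r + 12) fun a n b => ?_).of_eq fun a => ?_
  · have : PolyTime fun q : α × ℕ × Bool => f q.1 := by fun_prop
    fun_prop
  · have h₁ := sz_bit_le false n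
    have h₂ := sz_add_le (Nat.bit false n) (f a)
    have h₃ := sz_add_le (Nat.bit false n) 0
    have h₄ := sz_nat_mono (Nat.zero_le (Nat.bit false n))
    have h₅ := hr a
    have h₆ := eval_mono r (Nat.le_add_right (sz a) (sz b))
    cases b <;> simp at * <;> omega
  · rw [List.foldl_reverse]
    induction g a using Nat.binaryRec' with
    | zero => simp
    | bit b n hn ih =>
      rw [Nat.bits_append_bit _ _ hn, List.foldr_cons, ih]
      cases b <;> simp [Nat.bit_val] <;> ring

@[fun_prop]
theorem decide_le {f g : α → ℕ} (hf : PolyTime f) (hg : PolyTime g) :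
    PolyTime (fun a => decide (f a ≤ g a)) :=
  (hf.sub hg).bits.isEmpty.of_eq fun a => by
    rw [Bool.eq_iff_iff, List.isEmpty_iff_length_eq_zero, Nat.size_eq_bits_len, Nat.size_eq_zero]
    simp [Nat.sub_eq_zero_iff_le]

@[fun_prop]
theorem decide_eq {f g : α → ℕ} (hf : PolyTime f) (hg : PolyTime g) :
    PolyTime (fun a => decide (f a = g a)) :=
  ((hf.decide_le hg).and (hg.decide_le hf)).of_eq fun a => by
    rw [Bool.eq_iff_iff]
    simp [le_antisymm_iff]

@[fun_prop]
theorem max {f g : α → ℕ} (hf : PolyTime f) (hg : PolyTime g) :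
    PolyTime (fun a => Max.max (f a) (g a)) :=
  ((hf.decide_le hg).cond hg hf).of_eq fun a => by
    by_cases h : f a ≤ g a <;> simp [h]
    omega

@[fun_prop]
theorem length {f : α → List β} (hf : PolyTime f) : PolyTime (fun a => (f a).length) := by
  refine (foldl (f := fun _ n _ => n + 1) hf (const 0) (by fun_prop) 100
    fun a n _ => ?_).of_eq fun a => ?_
  · have := sz_add_le n 1
    have := sz_nat_le (m := 1) (k := 1) (by norm_num)
    simp
    omega
  · simp

@[fun_prop]
theorem getD {l : α → List β} {n : α → ℕ} (hl : PolyTime l) (hn : PolyTime n) (d : β) :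
    PolyTime (fun a => (l a).getD (n a) d) := by
  have hn' : PolyTime (fun q : α × (ℕ × β) × β => n q.1) := by fun_prop
  have h := (foldl (f := fun a (s : ℕ × β) x =>
    (s.1 + 1, bif decide (s.1 = n a) then x else s.2)) hl
    (const (0, d)) (by fun_prop) (.X + 100) fun a s x => ?_).snd
  · refine h.of_eq fun a => ?_
    have key : ∀ (l : List β) (i : ℕ) (d : β), (l.foldl (fun (s : ℕ × β) x =>
        (s.1 + 1, bif decide (s.1 = n a) then x else s.2)) (i, d)).2 =
        if i ≤ n a then l.getD (n a - i) d else d := by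
      intro l
      induction l with
      | nil => simp
      | cons x l ih =>
        intro i d
        rw [List.foldl_cons, ih]
        rcases lt_trichotomy i (n a) with h | h | h
        · obtain ⟨k, hk⟩ := Nat.exists_eq_add_of_lt h
          have h₁ : n a - i = k + 1 := by omega
          have h₂ : n a - (i + 1) = k := by omega
          have h₃ : i + 1 ≤ n a := by omega
          simp [h₁, h₂, h₃, h.le, h.ne]
        · simp [h]
        · have h₃ : ¬ i + 1 ≤ n a := by omega
          simp [h₃, h.not_ge, h.ne']
    simpa using key (l a) 0 d
  · have := sz_add_le s.1 1
    have := sz_nat_le (m := 1) (k := 1) (by norm_num)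
    have := one_le_sz s.1
    obtain ⟨i, d⟩ := s
    cases h : decide (i = n a) <;> simp at * <;> omega

end PolyTime

end

end PHom

namespace PHom

open Val Code
open Enc

/-! ### The algorithm -/

/-- One step of the parser, which reads the codes of the symbols from right to left. -/
def parseStep (acc : List (List ℕ)) (c : ℕ) : List (List ℕ) :=
  bif decide (c = 0) then (0 :: acc.headD []) :: acc.tail
  else bif decide (c = 1) then [] :: acc
  else bif decide (c ≤ 3) then
    (Nat.bit (decide (c = 3)) ((acc.headD []).headD 0) :: (acc.headD []).tail) :: acc.tail
  else (c :: acc.headD []) :: acc.tail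

/-- The sections of the input, as lists of numbers. -/
def parse (l : List ℕ) : List (List ℕ) := l.foldl parseStep []

/-- One step of cutting a list into pieces of length `k`, from right to left. -/
def chunkStep (k : ℕ) (acc : List (List ℕ)) (t : ℕ) : List (List ℕ) :=
  bif acc.isEmpty || decide ((acc.headD []).length = k) then [t] :: acc
  else (t :: acc.headD []) :: acc.tail

/-- Cut a list into pieces of length `k`. -/
def chunk (k : ℕ) (l : List ℕ) : List (List ℕ) := l.reverse.foldl (chunkStep k) []

/-- The constraints `[u, v, c, c']` imposed on homomorphisms by the edges `[u, v, R]`. -/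
def constraints (E : List (List ℕ)) : List (List ℕ) :=
  E.flatMap fun e =>
    [[e.getD 0 0, e.getD 1 0, e.getD 2 0 + e.getD 2 0, e.getD 2 0 + e.getD 2 0 + 1],
      [e.getD 1 0, e.getD 0 0, e.getD 2 0 + e.getD 2 0 + 1, e.getD 2 0 + e.getD 2 0]]

/-- The code of the `x`-th step of a path. -/
def codeAt (L : List (List ℕ)) (x : ℕ) : ℕ := (L.getD x []).headD 0

/-- The position `x` has a neighbor at `y` or beyond, along an edge with the given code. -/
def supported (L : List (List ℕ)) (x y c c' : ℕ) : Bool :=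
  decide (codeAt L x = c) && decide (y ≤ x + 1) ||
    decide (y + 1 ≤ x) && decide (codeAt L (x - 1) = c')

/-- The vertex `v` violates some constraint in `C`. -/
def violates (C L : List (List ℕ)) (h : List ℕ) (v : ℕ) : Bool :=
  C.any fun k => decide (k.getD 0 0 = v) &&
    !supported L (h.getD v 0) (h.getD (k.getD 1 0) 0) (k.getD 2 0) (k.getD 3 0)

/-- Move the vertices that violate some constraint to the next position. -/
def improve (V : List ℕ) (C L : List (List ℕ)) (h : List ℕ) : List ℕ :=
  V.map fun v => h.getD v 0 + bif violates C L h v then 1 else 0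

/-- The least homomorphism to the path with the steps `L`, if there is one. -/
def leastHom (V : List ℕ) (C L : List (List ℕ)) : List ℕ :=
  (V.flatMap fun _ => [] :: L).foldl (fun h _ => improve V C L h) []

/-- The last position reached by the least homomorphism. -/
def reach (V : List ℕ) (C L : List (List ℕ)) : ℕ := (leastHom V C L).foldl max 0

/-- One step of the computation of the numerators of the probabilities. -/
def dpRow (p q n : ℕ) (X : List ℕ) : List ℕ :=
  q * X.headD 0 :: X.map fun x => (q - p) * n + p * x

/-- The numerator of the probability of a homomorphism to the path with the steps `s.1`. -/
def dpValue (V : List ℕ) (C : List (List ℕ)) (s : List (List ℕ) × List ℕ) : ℕ :=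
  s.2.getD (reach V C s.1) 0

/-- Extend the path in front by a step. -/
def dpStep (V : List ℕ) (C : List (List ℕ)) (s : List (List ℕ) × List ℕ) (e : List ℕ) :
    List (List ℕ) × List ℕ :=
  (e :: s.1, dpRow (e.getD 1 0) (e.getD 2 0) (dpValue V C s) s.2)

/-- The numerators of the probabilities for a path with given reversed list of steps. -/
def dp (V : List ℕ) (C L : List (List ℕ)) : List (List ℕ) × List ℕ := L.foldl (dpStep V C) ([], [1])

/-- The edge `e` is incident to `v`. -/
def incident (v : ℕ) (e : List ℕ) : Bool := decide (e.getD 0 0 = v) || decide (e.getD 1 0 = v)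

/-- An end of the path with edges `E`. -/
def pathEnd (V : List ℕ) (E : List (List ℕ)) : ℕ :=
  (V.filter fun v => decide ((E.filter (incident v)).length ≤ 1)).headD 0

/-- The edge at `v` that does not lead back to `u`. -/
def nextEdge (E : List (List ℕ)) (v u : ℕ) : List ℕ :=
  (E.filter fun e => incident v e && !incident u e).headD []

/-- One step of a walk, whose state consists of the current and the previous vertex and of the
reversed list of the steps so far. -/
def walkStep (E : List (List ℕ)) (s : (ℕ × ℕ) × List (List ℕ)) : (ℕ × ℕ) × List (List ℕ) :=
  let e := nextEdge E s.1.1 s.1.2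
  let b := decide (e.getD 0 0 = s.1.1)
  ((bif b then e.getD 1 0 else e.getD 0 0, s.1.1),
    [bif b then e.getD 2 0 + e.getD 2 0 else e.getD 2 0 + e.getD 2 0 + 1, e.getD 3 0, e.getD 4 0] ::
      s.2)

/-- The reversed list of steps of the path with edges `E`. -/
def walk (V : List ℕ) (E : List (List ℕ)) : List (List ℕ) :=
  (E.foldl (fun s _ => walkStep E s) ((pathEnd V E, V.length), [])).2

/-- The reversed encoding of a pair of numbers; `[b]` stands for a bit and `[]` for a comma. -/
def encodeResult (x : ℕ × ℕ) : List (List Bool) :=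
  ((x.1.bits.map fun b => [b]) ++ [[]] ++ ((x.2.bits.map fun b => [b]) ++ [[]])).reverse

/-- The numerator and denominator of the result for parsed input. -/
def solveParsed (p : List (List ℕ)) : ℕ × ℕ :=
  let s := dp (p.getD 0 []) (constraints (chunk 3 (p.getD 1 [])))
    (walk (p.getD 2 []) (chunk 5 (p.getD 3 [])))
  (dpValue (p.getD 0 []) (constraints (chunk 3 (p.getD 1 []))) s, s.2.headD 0)

/-- The whole algorithm. -/
def solve (l : List ℕ) : List (List Bool) := encodeResult (solveParsed (parse l))

/-! ### The algorithm runs in polynomial time -/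

section

variable {α β γ δ : Type} [Enc α] [Enc β] [Enc γ] [Enc δ]

theorem sz_getD_le (l : List α) (i : ℕ) (d : α) : sz (l.getD i d) ≤ sz l + sz d := by
  by_cases h : i < l.length
  · have := sz_le_of_mem (List.getElem_mem h)
    rw [List.getD_eq_getElem _ _ h]
    omega
  · rw [List.getD_eq_default _ _ (by omega)]
    omega

theorem sz_headD_tail_le (l : List α) (d : α) : sz (l.headD d) + sz l.tail ≤ sz l + sz d := by
  cases l <;> simp <;> omega

namespace PolyTime

theorem parse : PolyTime parse := by
  refine foldl (f := fun _ => parseStep) id (const []) ?_ (.X + 100) fun _ b c => ?_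
  · unfold parseStep
    fun_prop
  · have h₁ := sz_headD_tail_le b []
    have h₂ := sz_headD_tail_le (b.headD []) 0
    have h₃ := sz_bit_le (decide (c = 3)) ((b.headD []).headD 0)
    have h₄ : sz 0 = 1 := rfl
    simp only [parseStep]
    cases decide (c = 0) <;> cases decide (c = 1) <;> cases decide (c ≤ 3) <;> simp at * <;> omega

theorem chunk (k : ℕ) : PolyTime (chunk k) := by
  refine foldl (f := fun _ => chunkStep k) (reverse id) (const []) ?_ (.X + 100) fun _ b c => ?_
  · unfold chunkStep
    fun_prop
  · have h₁ := sz_headD_tail_le b []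
    simp only [chunkStep]
    cases b.isEmpty || decide ((b.headD []).length = k) <;> simp at * <;> omega

theorem constraints : PolyTime constraints := flatMap id (by fun_prop)

@[fun_prop]
theorem codeAt {L : α → List (List ℕ)} {x : α → ℕ} (hL : PolyTime L) (hx : PolyTime x) :
    PolyTime (fun a => codeAt (L a) (x a)) := by
  unfold PHom.codeAt
  fun_prop

@[fun_prop]
theorem supported {L : α → List (List ℕ)} {x y c c' : α → ℕ} (hL : PolyTime L) (hx : PolyTime x)
    (hy : PolyTime y) (hc : PolyTime c) (hc' : PolyTime c') :
    PolyTime (fun a => supported (L a) (x a) (y a) (c a) (c' a)) := by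
  unfold PHom.supported
  fun_prop

@[fun_prop]
theorem violates {C L : α → List (List ℕ)} {h : α → List ℕ} {v : α → ℕ} (hC : PolyTime C)
    (hL : PolyTime L) (hh : PolyTime h) (hv : PolyTime v) :
    PolyTime (fun a => violates (C a) (L a) (h a) (v a)) := by
  refine any hC ?_
  fun_prop

@[fun_prop]
theorem improve {V h : α → List ℕ} {C L : α → List (List ℕ)} (hV : PolyTime V)
    (hC : PolyTime C) (hL : PolyTime L) (hh : PolyTime h) :
    PolyTime (fun a => improve (V a) (C a) (L a) (h a)) := by
  refine map hV ?_
  fun_prop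

end PolyTime

/-- After `k` rounds no position exceeds `k`, since a round adds at most one; the crude estimate `k
< 2 ^ k` bounds the bit lengths. -/
theorem sz_iterate_improve_le (V : List ℕ) (C L : List (List ℕ)) (l : List (List ℕ)) :
    sz (l.foldl (fun h _ => improve V C L h) []) ≤ V.length * (6 * l.length + 2) + 1 := by
  have h : ∀ v ∈ l.foldl (fun h _ => improve V C L h) [], v ≤ l.length := by
    induction l using List.reverseRecOn with
    | nil => simp
    | append_singleton l e ih =>
      rw [List.foldl_append, List.foldl_cons, List.foldl_nil]
      intro v hv
      simp only [improve, List.mem_map] at hv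
      obtain ⟨u, -, rfl⟩ := hv
      have h₁ : (l.foldl (fun h _ => improve V C L h) []).getD u 0 ≤ l.length := by
        by_cases hu : u < (l.foldl (fun h _ => improve V C L h) []).length
        · rw [List.getD_eq_getElem _ _ hu]
          exact ih _ (List.getElem_mem hu)
        · rw [List.getD_eq_default _ _ (by omega)]
          omega
      simp only [List.length_append, List.length_singleton]
      have h₂ : ∀ b : Bool, (bif b then 1 else 0) ≤ 1 := by decide
      have h₃ := h₂ (violates C L (l.foldl (fun h _ => improve V C L h) []) u)
      exact Nat.add_le_add h₁ h₃
  have h' : (l.foldl (fun h _ => improve V C L h) []).length ≤ V.length := by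
    induction l using List.reverseRecOn with
    | nil => simp
    | append_singleton l e ih => simp [improve]
  refine (sz_list_le (n := 6 * l.length + 1) fun v hv => ?_).trans ?_
  · exact sz_nat_le ((h v hv).trans_lt Nat.lt_two_pow_self)
  · gcongr

namespace PolyTime

theorem leastHom_aux :
    PolyTime fun q : List ℕ × List (List ℕ) × List (List ℕ) => leastHom q.1 q.2.1 q.2.2 := by
  refine foldl_of_bound
    (f := fun (q : List ℕ × List (List ℕ) × List (List ℕ)) h _ => PHom.improve q.1 q.2.1 q.2.2 h)
    (flatMap (by fun_prop) (by fun_prop)) (const []) (by fun_prop)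
    (.X * (6 * (.X * (.X + 1)) + 2) + 1) fun q l' hl' => ?_
  obtain ⟨V, C, L⟩ := q
  have h₀ := sz_iterate_improve_le V C L l'
  have h₁ : l'.length ≤ V.length * (L.length + 1) := by
    refine hl'.length_le.trans ?_
    simp [List.length_flatMap]
  have h₂ := length_le_sz V
  have h₃ := length_le_sz L
  refine h₀.trans ?_
  simp only [Polynomial.eval_add, Polynomial.eval_mul, Polynomial.eval_X, Polynomial.eval_one,
    Polynomial.eval_ofNat, sz_pair]
  gcongr
  · omega
  · refine h₁.trans ?_
    gcongr <;> omega

@[fun_prop]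
theorem reach {V : α → List ℕ} {C L : α → List (List ℕ)} (hV : PolyTime V) (hC : PolyTime C)
    (hL : PolyTime L) : PolyTime fun a => reach (V a) (C a) (L a) := by
  have h : PolyTime fun a => leastHom (V a) (C a) (L a) := leastHom_aux.comp (hV.pair (hC.pair hL))
  refine foldl (f := fun _ m n => Max.max m n) h (const 0) (by fun_prop) .X fun a b c => ?_
  rcases max_choice b c with h | h <;> simp [h] <;> omega

@[fun_prop]
theorem dpRow {p q n : α → ℕ} {X : α → List ℕ} (hp : PolyTime p) (hq : PolyTime q)
    (hn : PolyTime n) (hX : PolyTime X) : PolyTime fun a => dpRow (p a) (q a) (n a) (X a) :=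
  cons (by fun_prop) (map hX (by fun_prop))

@[fun_prop]
theorem dpValue {V : α → List ℕ} {C : α → List (List ℕ)} {s : α → List (List ℕ) × List ℕ}
    (hV : PolyTime V) (hC : PolyTime C) (hs : PolyTime s) :
    PolyTime fun a => dpValue (V a) (C a) (s a) := by
  unfold PHom.dpValue
  fun_prop

@[fun_prop]
theorem dpStep {V : α → List ℕ} {C : α → List (List ℕ)} {s : α → List (List ℕ) × List ℕ}
    {e : α → List ℕ} (hV : PolyTime V) (hC : PolyTime C) (hs : PolyTime s) (he : PolyTime e) :
    PolyTime fun a => dpStep (V a) (C a) (s a) (e a) := by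
  unfold PHom.dpStep
  fun_prop

end PolyTime

/-- A step multiplies the bound on the entries by at most `max p q`, whose bit length is already
counted in the size of the step. The bound must hold for arbitrary lists, not only for those that
describe probabilities, because `PolyTime` quantifies over all arguments. -/
theorem dp_bounds (V : List ℕ) (C L : List (List ℕ)) :
    sz (dp V C L).1 ≤ sz L ∧ (dp V C L).2.length = L.length + 1 ∧
      ∀ x ∈ (dp V C L).2, x < 2 ^ sz L := by
  induction L using List.reverseRecOn with
  | nil => simp [dp]
  | append_singleton L e ih =>
    obtain ⟨h₁, h₂, h₃⟩ := ih
    have hdp : dp V C (L ++ [e]) = dpStep V C (dp V C L) e := by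
      rw [dp, List.foldl_append]; rfl
    have hL := sz_append L [e]
    have hn : dpValue V C (dp V C L) < 2 ^ sz L := by
      by_cases hu : reach V C (dp V C L).1 < (dp V C L).2.length
      · rw [dpValue, List.getD_eq_getElem _ _ hu]
        exact h₃ _ (List.getElem_mem hu)
      · rw [dpValue, List.getD_eq_default _ _ (by omega)]
        positivity
    have hd : (dp V C L).2.headD 0 < 2 ^ sz L := by
      cases h : (dp V C L).2 with
      | nil => simp
      | cons x l => exact h₃ x (by simp [h])
    -- Both kinds of new entries are combinations with coefficients `a`, `b` of total at most `m`:
    -- here `m = q` for the head, and `m = max p q` for `(q - p) + p` with truncated subtraction.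
    have key : ∀ m a b n x, a + b ≤ m → sz m ≤ sz e + 1 → n < 2 ^ sz L → x < 2 ^ sz L →
        a * n + b * x < 2 ^ sz (L ++ [e]) := by
      intro m a b n x hm hs hn hx
      have hm' : m.size + sz L ≤ sz (L ++ [e]) := by
        rw [sz_nat] at hs
        simp at hL
        omega
      calc a * n + b * x ≤ a * 2 ^ sz L + b * 2 ^ sz L := by gcongr
        _ = (a + b) * 2 ^ sz L := by ring
        _ ≤ m * 2 ^ sz L := by gcongr
        _ < 2 ^ m.size * 2 ^ sz L := by gcongr; exact Nat.lt_size_self m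
        _ = 2 ^ (m.size + sz L) := by ring
        _ ≤ _ := Nat.pow_le_pow_right two_pos hm'
    have hp := sz_getD_le e 1 0
    have hq := sz_getD_le e 2 0
    have h₀ : sz 0 = 1 := rfl
    rw [hdp]
    refine ⟨?_, ?_, fun x hx => ?_⟩
    · simp [dpStep] at hL ⊢
      omega
    · simp [dpStep, dpRow, h₂]
    · simp only [dpStep, dpRow, List.mem_cons, List.mem_map] at hx
      rcases hx with rfl | ⟨x, hx, rfl⟩
      · simpa using key (e.getD 2 0) (e.getD 2 0) 0 _ 0 le_rfl (by omega) hd (by positivity)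
      · refine key (max (e.getD 1 0) (e.getD 2 0)) _ _ _ _ (by omega) ?_ hn (h₃ x hx)
        rcases max_choice (e.getD 1 0) (e.getD 2 0) with h | h <;> rw [h] <;> omega

namespace PolyTime

theorem dp_aux : PolyTime fun q : List ℕ × List (List ℕ) × List (List ℕ) => dp q.1 q.2.1 q.2.2 := by
  refine foldl_of_bound
    (f := fun (q : List ℕ × List (List ℕ) × List (List ℕ)) s e => PHom.dpStep q.1 q.2.1 s e)
    (by fun_prop) (by fun_prop) (by fun_prop) (.X + ((.X + 1) * (6 * .X + 2) + 1) + 1)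
    fun q l' hl' => ?_
  obtain ⟨V, C, L⟩ := q
  obtain ⟨h₁, h₂, h₃⟩ := dp_bounds V C l'
  have h₄ := sz_list_le fun x hx => sz_nat_le (h₃ x hx)
  have h₅ : sz l' ≤ sz L := sz_le_of_sublist hl'.sublist
  have h₆ := length_le_sz l'
  rw [h₂] at h₄
  change sz ((dp V C l').1, (dp V C l').2) ≤ _
  simp only [Polynomial.eval_add, Polynomial.eval_mul, Polynomial.eval_X, Polynomial.eval_one,
    Polynomial.eval_ofNat, sz_pair]
  gcongr
  · omega
  · refine h₄.trans ?_
    gcongr <;> omega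

@[fun_prop]
theorem incident {e : α → List ℕ} {v : α → ℕ} (hv : PolyTime v) (he : PolyTime e) :
    PolyTime fun a => incident (v a) (e a) := by
  unfold PHom.incident
  fun_prop

theorem pathEnd_aux : PolyTime fun q : List ℕ × List (List ℕ) => pathEnd q.1 q.2 := by
  refine headD (filter fst_aux ?_) 0
  have : PolyTime fun q : (List ℕ × List (List ℕ)) × ℕ => q.1.2.filter (PHom.incident q.2) :=
    filter (by fun_prop) (by fun_prop)
  fun_prop

@[fun_prop]
theorem nextEdge {E : α → List (List ℕ)} {v u : α → ℕ} (hE : PolyTime E) (hv : PolyTime v)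
    (hu : PolyTime u) : PolyTime fun a => nextEdge (E a) (v a) (u a) :=
  headD (filter hE (by fun_prop)) []

theorem walk_aux : PolyTime fun q : List ℕ × List (List ℕ) => walk q.1 q.2 := by
  have h : PolyTime fun q : List ℕ × List (List ℕ) =>
    ((pathEnd q.1 q.2, q.1.length), ([] : List (List ℕ))) :=
    (pathEnd_aux.pair (by fun_prop)).pair (const [])
  refine (foldl (f := fun (q : List ℕ × List (List ℕ)) s (_ : List ℕ) => walkStep q.2 s)
    snd_aux h ?_
    (5 * .X + 100) fun q s _ => ?_).snd
  · unfold walkStep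
    fun_prop
  · have he : sz (PHom.nextEdge q.2 s.1.1 s.1.2) ≤ sz q.2 + 1 := by
      have h₁ := sz_headD_tail_le (q.2.filter fun e => PHom.incident s.1.1
        e && !PHom.incident s.1.2 e) []
      have h₂ := sz_le_of_sublist (List.filter_sublist (l := q.2)
        (p := fun e => PHom.incident s.1.1 e && !PHom.incident s.1.2 e))
      have h₃ := one_le_sz (q.2.filter fun e => PHom.incident s.1.1
        e && !PHom.incident s.1.2 e).tail
      simp only [PHom.nextEdge, sz_nil] at *
      omega
    obtain ⟨V, E⟩ := q
    obtain ⟨⟨u, v⟩, l⟩ := s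
    simp only [walkStep, sz_pair, sz_cons, sz_nil] at he ⊢
    generalize PHom.nextEdge E u v = e at he ⊢
    have h₀ := sz_getD_le e 0 0
    have h₁ := sz_getD_le e 1 0
    have h₂ := sz_getD_le e 2 0
    have h₃ := sz_getD_le e 3 0
    have h₄ := sz_getD_le e 4 0
    have h₅ := sz_add_le (e.getD 2 0) (e.getD 2 0)
    have h₆ := sz_add_le (e.getD 2 0 + e.getD 2 0) 1
    have h₇ : sz 0 = 1 := rfl
    have h₈ : sz 1 = 7 := rfl
    have h₉ := one_le_sz (e.getD 2 0 + e.getD 2 0)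
    simp only [Polynomial.eval_add, Polynomial.eval_mul, Polynomial.eval_X, Polynomial.eval_ofNat]
    cases decide (e.getD 0 0 = u) <;> simp only [cond_true, cond_false] <;> omega

theorem encodeResult {x : α → ℕ × ℕ} (hx : PolyTime x) : PolyTime fun a => encodeResult (x a) := by
  have h : PolyTime fun n : ℕ => n.bits.map fun b => [b] := map (by fun_prop) (by fun_prop)
  have h₁ : PolyTime fun a => (x a).1.bits.map fun b => [b] := h.comp hx.fst
  have h₂ : PolyTime fun a => (x a).2.bits.map fun b => [b] := h.comp hx.snd
  unfold PHom.encodeResult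
  fun_prop

theorem solveParsed : PolyTime solveParsed := by
  have h₁ : PolyTime fun p : List (List ℕ) => PHom.constraints (PHom.chunk 3 (p.getD 1 [])) :=
    constraints.comp ((chunk 3).comp (by fun_prop))
  have h₂ : PolyTime fun p : List (List ℕ) => walk (p.getD 2 []) (PHom.chunk 5 (p.getD 3 [])) :=
    walk_aux.comp (g := fun p : List (List ℕ) => (p.getD 2 [], PHom.chunk 5 (p.getD 3 [])))
      (pair (by fun_prop) ((chunk 5).comp (by fun_prop)))
  have h₄ : PolyTime fun p : List (List ℕ) => p.getD 0 [] := by fun_prop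
  have h₃ : PolyTime fun p : List (List ℕ) => dp (p.getD 0 [])
      (PHom.constraints (PHom.chunk 3 (p.getD 1 [])))
      (walk (p.getD 2 []) (PHom.chunk 5 (p.getD 3 []))) :=
    dp_aux.comp (g := fun p : List (List ℕ) => (p.getD 0 [],
      PHom.constraints (PHom.chunk 3 (p.getD 1 [])),
      walk (p.getD 2 []) (PHom.chunk 5 (p.getD 3 [])))) (h₄.pair (h₁.pair h₂))
  have h₅ := dpValue h₄ h₁ h₃
  have h₆ := h₃.snd.headD 0
  exact h₅.pair h₆

theorem solve : PolyTime solve := encodeResult (solveParsed.comp parse)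

end PolyTime

end

end PHom

namespace PHom

open Val Code
open Enc
open Turing

/-! ### Compilation to Turing machines -/

section Machine

variable {σ Λ : Type}

/-- The alphabets of the stacks: one for the input and the output, and the four stacks of bits. -/
@[reducible]
def Alphabet (σ : Type) : Option Stk → Type
  | none => Symbol σ
  | some _ => Bool

/-- The internal memory of the machines. -/
abbrev Register (σ : Type) := Option (Symbol σ)

/-- The bit in the register. -/
def Register.toBit : Register σ → Option Bool
  | some (.bit b) => some b
  | _ => none

/-- The contents of all stacks. -/
def contents (io : List (Symbol σ)) (s : Store) : ∀ k, List (Alphabet σ k)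
  | none => io
  | some k => s.get k

theorem update_contents (io : List (Symbol σ)) (s : Store) (k : Stk) (l : List Bool) :
    Function.update (contents io s) (some k) l = contents io (s.set k l) := by
  funext k'
  rcases k' with - | k'
  · rfl
  · by_cases h : k' = k
    · subst h
      simp [contents, Store.get_set]
    · have : (some k' : Option Stk) ≠ some k := by simpa using h
      simp [contents, Store.get_set, h]

theorem update_contents_none (io io' : List (Symbol σ)) (s : Store) :
    Function.update (contents io s) none io' = contents io' s := by
  funext k'
  rcases k' with - | k'
  · simp [contents]
  · rfl

/-- The labels of the compiled program. -/
inductive Code.Lbl : Code → Type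
  | push {k b} : Lbl (.push k b)
  | pop {k e on} : Lbl (.pop k e on)
  | onEmpty {k e on} (l : Lbl e) : Lbl (.pop k e on)
  | on {k e on} (b : Bool) (l : Lbl (on b)) : Lbl (.pop k e on)
  | fst {c d} (l : Lbl c) : Lbl (.seq c d)
  | snd {c d} (l : Lbl d) : Lbl (.seq c d)
  | test {k p c} : Lbl (.loop k p c)
  | body {k p c} (l : Lbl c) : Lbl (.loop k p c)

instance Code.finite_lbl (c : Code) : Finite c.Lbl := by
  induction c with
  | skip =>
    have : IsEmpty (Lbl skip) := ⟨fun l => nomatch l⟩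
    infer_instance
  | push k b =>
    exact Finite.of_surjective (fun _ : Unit => .push) fun l => by cases l; exact ⟨(), rfl⟩
  | pop k e on ihe ihon =>
    refine Finite.of_surjective
      (fun o : Option (e.Lbl ⊕ Σ b, (on b).Lbl) => match o with
        | none => .pop
        | some (.inl l) => .onEmpty l
        | some (.inr ⟨b, l⟩) => .on b l) fun l => ?_
    cases l with
    | pop => exact ⟨none, rfl⟩
    | onEmpty l => exact ⟨some (.inl l), rfl⟩
    | on b l => exact ⟨some (.inr ⟨b, l⟩), rfl⟩
  | seq c d ihc ihd =>
    refine Finite.of_surjective (Sum.elim .fst .snd : c.Lbl ⊕ d.Lbl → _) fun l => ?_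
    cases l with
    | fst l => exact ⟨.inl l, rfl⟩
    | snd l => exact ⟨.inr l, rfl⟩
  | loop k p c ih =>
    refine Finite.of_surjective (fun o : Option c.Lbl => o.elim .test .body) fun l => ?_
    cases l with
    | test => exact ⟨none, rfl⟩
    | body l => exact ⟨some l, rfl⟩

/-- The label where the compiled program starts. -/
def Code.entry : (c : Code) → (c.Lbl → Λ) → Λ → Λ
  | .skip, _, x => x
  | .push _ _, emb, _ => emb .push
  | .pop _ _ _, emb, _ => emb .pop
  | .seq c d, emb, x => c.entry (fun l => emb (.fst l)) (d.entry (fun l => emb (.snd l)) x)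
  | .loop _ _ _, emb, _ => emb .test

/-- The statements of the compiled program, which finally jumps to the label `x`. -/
def Code.stmt : {c : Code} → (c.Lbl → Λ) → Λ → c.Lbl → TM2.Stmt (Alphabet σ) Λ (Register σ)
  | .push k b, _, x, .push => .push (some k) (fun _ => b) (.goto fun _ => x)
  | .pop k e on, emb, x, .pop => .pop (some k) (fun _ o => o.map Symbol.bit) <| .goto fun v =>
      match v.toBit with
      | none => e.entry (fun l => emb (.onEmpty l)) x
      | some b => (on b).entry (fun l => emb (.on b l)) x
  | .pop _ _ _, emb, x, .onEmpty l => stmt (fun l => emb (.onEmpty l)) x l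
  | .pop _ _ _, emb, x, .on b l => stmt (fun l => emb (.on b l)) x l
  | .seq _ d, emb, x, .fst l => stmt (fun l => emb (.fst l)) (d.entry (fun l => emb (.snd l)) x) l
  | .seq _ _, emb, x, .snd l => stmt (fun l => emb (.snd l)) x l
  | .loop k p c, emb, x, .test => .peek (some k) (fun _ o => o.map Symbol.bit) <| .goto fun v =>
      bif p v.toBit then c.entry (fun l => emb (.body l)) (emb .test) else x
  | .loop _ _ _, emb, _, .body l => stmt (fun l => emb (.body l)) (emb .test) l

/-- The machine goes from one configuration to another in `n` steps. -/
def Steps (M : Λ → TM2.Stmt (Alphabet σ) Λ (Register σ)) (n : ℕ)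
    (a b : TM2.Cfg (Alphabet σ) Λ (Register σ)) : Prop :=
  (flip bind (TM2.step M))^[n] (some a) = some b

variable {M : Λ → TM2.Stmt (Alphabet σ) Λ (Register σ)}

theorem Steps.refl (a : TM2.Cfg (Alphabet σ) Λ (Register σ)) : Steps M 0 a a := rfl

theorem Steps.trans {n m : ℕ} {a b c : TM2.Cfg (Alphabet σ) Λ (Register σ)} (h : Steps M n a b)
    (h' : Steps M m b c) : Steps M (n + m) a c := by
  rw [Steps, Nat.add_comm, Function.iterate_add_apply, h, h']

theorem Steps.one {l : Λ} {v : Register σ} {S : ∀ k, List (Alphabet σ k)}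
    {b : TM2.Cfg (Alphabet σ) Λ (Register σ)} (h : TM2.stepAux (M l) v S = b) :
    Steps M 1 ⟨some l, v, S⟩ b := congrArg some h

/-- Sequencing and `skip` cost nothing on either side, as `entry` resolves them to jump targets at
compile time; every other program step is one machine statement. The step counts thus agree exactly.
The register needs no invariant, since each test reloads it. -/
theorem Run.steps {c : Code} {s s' : Store} {n : ℕ} (r : Run c s s' n) (emb : c.Lbl → Λ) (x : Λ)
    (hM : ∀ l, M (emb l) = Code.stmt emb x l) (v : Register σ) (io : List (Symbol σ)) :
    ∃ v', Steps M n ⟨some (c.entry emb x), v, contents io s⟩ ⟨some x, v', contents io s'⟩ := by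
  induction r generalizing x v with
  | skip s => exact ⟨v, .refl _⟩
  | push k b s =>
    refine ⟨v, .one ?_⟩
    rw [entry, hM]
    simp only [Code.stmt, TM2.stepAux]
    rw [update_contents]; rfl
  | @pop_nil k e on s s' n h _ ih =>
    obtain ⟨v', h'⟩ := ih (fun l => emb (.onEmpty l)) x (fun l => hM _) none
    refine ⟨v', Nat.add_comm .. ▸ Steps.trans (.one ?_) h'⟩
    rw [entry, hM]
    simp only [Code.stmt, TM2.stepAux]
    have h₁ : s.set k [] = s := by cases s; cases k <;> simp_all [Store.set, Store.get]
    rw [update_contents]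
    simp [contents, h, Register.toBit, h₁]
  | @pop_cons k e on s s' n b l h _ ih =>
    obtain ⟨v', h'⟩ := ih (fun l => emb (.on b l)) x (fun l => hM _) (some (.bit b))
    refine ⟨v', Nat.add_comm .. ▸ Steps.trans (.one ?_) h'⟩
    rw [entry, hM]
    simp only [Code.stmt, TM2.stepAux]
    rw [update_contents]
    simp [contents, h, Register.toBit]
  | seq _ _ ih₁ ih₂ =>
    obtain ⟨v', h₁⟩ := ih₁ (fun l => emb (.fst l)) _ (fun l => hM _) v
    obtain ⟨v'', h₂⟩ := ih₂ (fun l => emb (.snd l)) _ (fun l => hM _) v'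
    exact ⟨v'', h₁.trans h₂⟩
  | @loop_done k p c s h =>
    refine ⟨(s.get k).head?.map .bit, .one ?_⟩
    rw [entry, hM]
    have h₁ : Register.toBit ((s.get k).head?.map (Symbol.bit (σ := σ))) = (s.get k).head? := by
      cases s.get k <;> rfl
    simp only [Code.stmt, TM2.stepAux, contents, h₁, h, cond_false]
  | @loop_step k p c s s' s'' n m h _ _ ih₁ ih₂ =>
    obtain ⟨v', h₁⟩ := ih₁ (fun l => emb (.body l)) (emb .test) (fun l => hM _)
      ((s.get k).head?.map .bit)
    obtain ⟨v'', h₂⟩ := ih₂ emb x hM v'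
    refine ⟨v'', Nat.add_comm .. ▸ Steps.trans (.one ?_) (h₁.trans h₂)⟩
    rw [entry, hM]
    have h₁ : Register.toBit ((s.get k).head?.map (Symbol.bit (σ := σ))) = (s.get k).head? := by
      cases s.get k <;> rfl
    simp only [Code.stmt, TM2.stepAux, contents, h₁, h, cond_true]

/-! ### The complete machine: reading, running, writing -/

/-- The labels of the machine that reads the input, runs the program, and writes the output. -/
inductive MachineLbl (c : Code)
  | init
  | read
  | run (l : c.Lbl)
  | write

instance (c : Code) : Finite (MachineLbl c) := by
  refine Finite.of_surjective (fun o : Option (Option (Option c.Lbl)) => match o with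
    | none => .init
    | some none => .read
    | some (some none) => .write
    | some (some (some l)) => .run l) fun l => ?_
  cases l with
  | init => exact ⟨none, rfl⟩
  | read => exact ⟨some none, rfl⟩
  | run l => exact ⟨some (some (some l)), rfl⟩
  | write => exact ⟨some (some none), rfl⟩

instance [Finite σ] : Finite (Symbol σ) := by
  refine Finite.of_surjective (Sum.elim .bit (Sum.elim .label
    fun b => bif b then .comma else .semicolon) : Bool ⊕ σ ⊕ Bool → Symbol σ) fun s => ?_
  cases s with
  | bit b => exact ⟨.inl b, rfl⟩
  | label R => exact ⟨.inr (.inl R), rfl⟩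
  | comma => exact ⟨.inr (.inr true), rfl⟩
  | semicolon => exact ⟨.inr (.inr false), rfl⟩

/-- Push a list of bits on the main stack. -/
def pushStmt (l : List Bool) (q : TM2.Stmt (Alphabet σ) Λ (Register σ)) :
    TM2.Stmt (Alphabet σ) Λ (Register σ) :=
  l.foldl (fun q b => .push (some .S) (fun _ => b) q) q

/-- Pop a bit off the main stack. -/
def discard (q : TM2.Stmt (Alphabet σ) Λ (Register σ)) : TM2.Stmt (Alphabet σ) Λ (Register σ) :=
  .pop (some .S) (fun v _ => v) q

/-- Pop a bit off the main stack to the register. -/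
def fetch (q : TM2.Stmt (Alphabet σ) Λ (Register σ)) : TM2.Stmt (Alphabet σ) Λ (Register σ) :=
  .pop (some .S) (fun _ o => o.map .bit) q

open Classical in
/-- Push the bits that represent the symbol in the register in front of a list. -/
noncomputable def pushSymbol (code : Symbol σ → ℕ) (q : TM2.Stmt (Alphabet σ) Λ (Register σ)) :
    List (Symbol σ) → TM2.Stmt (Alphabet σ) Λ (Register σ)
  | [] => .halt
  | t :: ts => .branch (fun v => decide (v = some t)) (pushStmt (true :: (enc (code t)).ser) q)
      (pushSymbol code q ts)

theorem stepAux_pushStmt (l : List Bool) (q : TM2.Stmt (Alphabet σ) Λ (Register σ))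
    (v : Register σ) (io : List (Symbol σ)) (s : List Bool) :
    TM2.stepAux (pushStmt l q) v (contents io (onTop s)) =
      TM2.stepAux q v (contents io (onTop (l ++ s))) := by
  induction l generalizing q with
  | nil => rfl
  | cons b l ih =>
    rw [pushStmt, List.foldl_cons]
    refine (ih _).trans ?_
    rw [TM2.stepAux, update_contents]
    rfl

theorem stepAux_pushSymbol (code : Symbol σ → ℕ) (q : TM2.Stmt (Alphabet σ) Λ (Register σ))
    (ts : List (Symbol σ)) (t : Symbol σ) (ht : t ∈ ts) (io : List (Symbol σ)) (s : List Bool) :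
    TM2.stepAux (pushSymbol code q ts) (some t) (contents io (onTop s)) =
      TM2.stepAux q (some t) (contents io (onTop (true :: (enc (code t)).ser ++ s))) := by
  induction ts with
  | nil => simp at ht
  | cons u ts ih =>
    rw [pushSymbol, TM2.stepAux]
    by_cases h : t = u
    · subst h
      simp [stepAux_pushStmt]
    · simp [h, ih ((List.mem_cons.1 ht).resolve_left h)]

theorem stepAux_discard (q : TM2.Stmt (Alphabet σ) Λ (Register σ))
    (v : Register σ) (io : List (Symbol σ)) (s : List Bool) (b : Bool) :
    TM2.stepAux (discard q) v (contents io (onTop (b :: s))) =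
      TM2.stepAux q v (contents io (onTop s)) := by
  rw [discard, TM2.stepAux, update_contents]
  rfl

theorem stepAux_fetch (q : TM2.Stmt (Alphabet σ) Λ (Register σ))
    (v : Register σ) (io : List (Symbol σ)) (s : List Bool) (b : Bool) :
    TM2.stepAux (fetch q) v (contents io (onTop (b :: s))) =
      TM2.stepAux q (some (.bit b)) (contents io (onTop s)) := by
  rw [fetch, TM2.stepAux, update_contents]
  rfl

/-- The machine that reads the input, runs the program `c`, and writes the output. -/
noncomputable def machine (code : Symbol σ → ℕ) (syms : List (Symbol σ)) (c : Code) :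
    MachineLbl c → TM2.Stmt (Alphabet σ) (MachineLbl c) (Register σ)
  | .init => pushStmt [false] (.goto fun _ => .read)
  | .read => .pop none (fun _ o => o) <| .branch Option.isSome
      (pushSymbol code (.goto fun _ => .read) syms) (.goto fun _ => c.entry .run .write)
  | .run l => Code.stmt .run .write l
  | .write => fetch <| .branch (fun v => v.toBit.getD false)
      (fetch <| .branch (fun v => v.toBit.getD false)
        (discard <| fetch <| discard <| discard <| discard <| discard <|
          .push none (fun v => .bit (v.toBit.getD false)) <| .goto fun _ => .write)
        (.push none (fun _ => .comma) <| .goto fun _ => .write))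
      (.load (fun _ => none) .halt)

/-- The output symbols: bits and commas. -/
def outSymbol : Option Bool → Symbol σ
  | none => .comma
  | some b => .bit b

/-- Each symbol read is put in front of the list built so far, so the program receives the input
reversed. This is the order in which the parser wants it. -/
theorem steps_read (code : Symbol σ → ℕ) (syms : List (Symbol σ)) (hs : ∀ t, t ∈ syms) (c : Code)
    (w : List (Symbol σ)) (acc : List ℕ) (v : Register σ) :
    ∃ v', Steps (machine code syms c) (w.length + 1)
      ⟨some .read, v, contents w (onTop (enc acc).ser)⟩
      ⟨some (c.entry .run .write), v',
        contents [] (onTop (enc ((w.map code).reverse ++ acc)).ser)⟩ := by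
  induction w generalizing acc v with
  | nil =>
    refine ⟨none, .one ?_⟩
    rw [machine, TM2.stepAux, update_contents_none]
    rfl
  | cons t w ih =>
    obtain ⟨v', h⟩ := ih (code t :: acc) (some t)
    refine ⟨v', ?_⟩
    rw [List.length_cons, Nat.add_comm (w.length + 1)]
    refine .trans (.one ?_) (by simpa using h)
    rw [machine, TM2.stepAux, update_contents_none]
    exact stepAux_pushSymbol code _ syms t (hs t) _ _

/-- Writing to a stack reverses as well, so the program has to deliver its result backwards. A comma
is coded by the empty list and a bit by a singleton, whose code has fixed length; the six pops after
the two tests remove it. -/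
theorem steps_write (code : Symbol σ → ℕ) (syms : List (Symbol σ)) (c : Code)
    (o : List (Option Bool)) (io : List (Symbol σ)) (v : Register σ) :
    Steps (machine code syms c) (o.length + 1)
      ⟨some .write, v, contents io (onTop (enc (o.map Option.toList)).ser)⟩
      ⟨none, none, contents ((o.map outSymbol).reverse ++ io) (onTop [])⟩ := by
  induction o generalizing io v with
  | nil =>
    refine .one ?_
    rw [machine]
    exact stepAux_fetch ..
  | cons x o ih =>
    rw [List.length_cons, Nat.add_comm (o.length + 1)]
    have h := ih (outSymbol x :: io) (some (.bit (x.getD false)))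
    refine .trans (.one ?_) (by simpa using h)
    have hpush : ∀ (io' : List (Symbol σ)) (s : Store) (t : Symbol σ),
        Function.update (contents io' s) none (t :: contents io' s none) = contents (t :: io') s :=
      fun io' s t => update_contents_none io' (t :: io') s
    rw [machine]
    rcases x with - | - | -
    · have hs : (enc ((none :: o).map Option.toList)).ser =
          true :: false :: (enc (o.map Option.toList)).ser := rfl
      rw [hs]
      simp [stepAux_fetch, Register.toBit, hpush, outSymbol]
    · have hs : (enc ((some false :: o).map Option.toList)).ser = true :: true :: true :: false ::
          true :: false :: false :: false :: (enc (o.map Option.toList)).ser := rfl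
      rw [hs]
      simp [stepAux_fetch, stepAux_discard, Register.toBit, hpush, outSymbol]
    · have hs : (enc ((some true :: o).map Option.toList)).ser = true :: true :: true :: true ::
          false :: false :: false :: false :: (enc (o.map Option.toList)).ser := rfl
      rw [hs]
      simp [stepAux_fetch, stepAux_discard, Register.toBit, hpush, outSymbol]

/-- The machine that reads the input, runs the program `c`, and writes the output. -/
noncomputable def finMachine [Finite σ] (code : Symbol σ → ℕ) (c : Code) : FinTM2 where
  K := Option Stk
  k₀ := none
  k₁ := none
  Γ := Alphabet σ
  Λ := MachineLbl c
  ΛFin := Fintype.ofFinite _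
  main := .init
  σ := Register σ
  initialState := none
  σFin := Fintype.ofFinite _
  Γk₀Fin := Fintype.ofFinite (Symbol σ)
  m := machine code (Set.finite_univ (α := Symbol σ)).toFinset.toList c

theorem initList_finMachine [Finite σ] (code : Symbol σ → ℕ) (c : Code) (w : List (Symbol σ)) :
    initList (finMachine code c) w = ⟨some .init, none, contents w (onTop [])⟩ := by
  refine congrArg (TM2.Cfg.mk _ _) (funext fun k => ?_)
  rcases k with - | - | - | - | - <;> rfl

/-- Halting with output requires empty work stacks and the initial register, which is why the
machine clears its register before it halts. -/
theorem haltList_finMachine [Finite σ] (code : Symbol σ → ℕ) (c : Code) (w : List (Symbol σ)) :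
    haltList (finMachine code c) w = ⟨none, none, contents w (onTop [])⟩ := by
  refine congrArg (TM2.Cfg.mk _ _) (funext fun k => ?_)
  rcases k with - | - | - | - | - <;> rfl

theorem PolyTime.exists_machine [Finite σ] {α β : Type} {ea : α → List (Symbol σ)}
    {eb : β → List (Symbol σ)} {f : α → β} (code : Symbol σ → ℕ) {F : List ℕ → List (List Bool)}
    (hF : PolyTime F) (o : α → List (Option Bool))
    (ho : ∀ a, F ((ea a).map code).reverse = ((o a).map Option.toList).reverse)
    (hb : ∀ a, eb (f a) = (o a).map outSymbol) :
    Nonempty (TM2ComputableInPolyTime ea eb f) := by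
  obtain ⟨q, hq⟩ := hF.exists_sz_le
  obtain ⟨c, p, hc⟩ := hF
  obtain ⟨K, hK⟩ : ∃ K, ∀ t, sz (code t) ≤ K := by
    have := Fintype.ofFinite (Symbol σ)
    exact ⟨Finset.univ.sup fun t => sz (code t),
      fun t => Finset.le_sup (f := fun t => sz (code t)) (by simp)⟩
  -- The terms are the length of the input for reading, `p` for the run and `q` for the length of
  -- the output, both at the size of the coded input, and one extra step each for starting, reading
  -- and writing.
  obtain ⟨P, hP⟩ : ∃ P : Polynomial ℕ, P = .X + (p + q).comp (.C (K + 1) * .X + 1) + 3 := ⟨_, rfl⟩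
  have key : ∀ a, ∃ n ≤ P.eval (ea a).length,
    Steps (finMachine code c).m n ⟨some .init, none, contents (ea a) (onTop [])⟩
        ⟨none, none, contents (eb (f a)) (onTop [])⟩ := by
    intro a
    have hM : Steps (finMachine code c).m 1
        ⟨some .init, none, contents (ea a) (onTop [])⟩
        ⟨some .read, none, contents (ea a) (onTop (enc ([] : List ℕ)).ser)⟩ :=
      .one (stepAux_pushStmt [false] _ none (ea a) [])
    obtain ⟨v₁, h₁⟩ := steps_read code (Set.finite_univ (α := Symbol σ)).toFinset.toList (by simp) c
      (ea a) [] none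
    obtain ⟨n, hn, r⟩ := hc (((ea a).map code).reverse) []
    obtain ⟨v₂, h₂⟩ := r.steps (M := (finMachine code c).m) .run .write (fun l => rfl) v₁ []
    have h₃ := steps_write code (Set.finite_univ (α := Symbol σ)).toFinset.toList c
      (o a).reverse [] v₂
    have ho' : F ((ea a).map code).reverse = (o a).reverse.map Option.toList := by
      rw [ho, List.map_reverse]
    rw [ho', List.append_nil] at h₂
    rw [List.append_nil] at h₁ h₂
    have h := (hM.trans h₁).trans (h₂.trans h₃)
    rw [List.map_reverse, List.reverse_reverse, List.append_nil, ← hb] at h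
    have hsz : sz ((ea a).map code).reverse ≤ (K + 1) * (ea a).length + 1 := by
      rw [sz_reverse]
      refine (sz_list_le (n := K) fun x hx => ?_).trans (by simp [Nat.mul_comm])
      obtain ⟨t, -, rfl⟩ := List.mem_map.1 hx
      exact hK t
    have hlen : (o a).length ≤ q.eval ((K + 1) * (ea a).length + 1) := by
      refine le_trans ?_ ((hq _).trans (eval_mono q hsz))
      rw [ho]
      refine le_trans ?_ (length_le_sz _)
      simp
    refine ⟨_, ?_, h⟩
    have := hn.trans (eval_mono p hsz)
    rw [hP]
    simp
    omega
  choose n hn h using key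
  exact ⟨{
    tm := finMachine code c
    inputAlphabet := Equiv.refl (Symbol σ)
    outputAlphabet := Equiv.refl (Symbol σ)
    time := P
    outputsFun := fun a =>
      { steps := n a
        evals_in_steps := by
          have h₁ : initList (finMachine code c) _ = _ :=
            (congrArg _ (List.map_id (ea a))).trans (initList_finMachine code c (ea a))
          have h₂ : haltList (finMachine code c) _ = _ :=
            (congrArg _ (List.map_id (eb (f a)))).trans (haltList_finMachine code c (eb (f a)))
          exact (congrArg (fun x => (flip bind (finMachine code c).step)^[n a] (some x)) h₁).trans
            (Eq.trans (h a) (congrArg some h₂.symm))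
        steps_le_m := hn a } }⟩

end Machine

end PHom

namespace PHom

/-! ### Correctness of the computation of the least homomorphism -/

/-- The positions `x` and `y` are joined by an edge with the given code. -/
def Sat (L : List (List ℕ)) (x y c c' : ℕ) : Prop :=
  y = x + 1 ∧ codeAt L x = c ∨ x = y + 1 ∧ codeAt L y = c'

/-- The assignment `g` of positions to vertices satisfies all constraints. -/
def SatAll (C L : List (List ℕ)) (g : ℕ → ℕ) : Prop :=
  ∀ k ∈ C, Sat L (g (k.getD 0 0)) (g (k.getD 1 0)) (k.getD 2 0) (k.getD 3 0)

/-- Constraints on the vertices `0, …, n - 1` that are closed under reversal. -/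
structure ProperConstraints (n : ℕ) (C : List (List ℕ)) : Prop where
  lt : ∀ k ∈ C, k.getD 0 0 < n
  ne : ∀ k ∈ C, k.getD 2 0 ≠ k.getD 3 0
  symm : ∀ k ∈ C, [k.getD 1 0, k.getD 0 0, k.getD 3 0, k.getD 2 0] ∈ C

theorem supported_iff {L : List (List ℕ)} {x y c c' : ℕ} : supported L x y c c' = true ↔
    codeAt L x = c ∧ y ≤ x + 1 ∨ y + 1 ≤ x ∧ codeAt L (x - 1) = c' := by
  simp [supported]

theorem Sat.supported {L : List (List ℕ)} {x y z c c' : ℕ} (h : Sat L x y c c') (hz : z ≤ y) :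
    supported L x z c c' = true := by
  rw [supported_iff]
  rcases h with ⟨rfl, h⟩ | ⟨rfl, h⟩
  · exact .inl ⟨h, hz⟩
  · exact .inr ⟨by omega, h⟩

/-- Mutual support forces `x` and `y` to differ by at most one. They cannot be equal, as both
supports would then use the same step of the path, with codes `c` and `c'`. The remaining cases are
the two ways of being adjacent. -/
theorem sat_of_supported {L : List (List ℕ)} {x y c c' : ℕ} (hc : c ≠ c')
    (h₁ : supported L x y c c' = true) (h₂ : supported L y x c' c = true) : Sat L x y c c' := by
  rw [supported_iff] at h₁ h₂
  rcases h₁ with ⟨h₁, h₁'⟩ | ⟨h₁, h₁'⟩ <;> rcases h₂ with ⟨h₂, h₂'⟩ | ⟨h₂, h₂'⟩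
  · rcases Nat.lt_trichotomy x y with h | rfl | h
    · exact .inl ⟨by omega, h₁⟩
    · exact absurd (h₁.symm.trans h₂) hc
    · exact .inr ⟨by omega, h₂⟩
  · exact .inl ⟨by omega, h₁⟩
  · exact .inr ⟨by omega, h₂⟩
  · omega

/-- The assignment of positions given by a list. -/
def assignment (h : List ℕ) (v : ℕ) : ℕ := h.getD v 0

variable {n : ℕ} {C L : List (List ℕ)}

theorem violates_iff {h : List ℕ} {v : ℕ} : violates C L h v = true ↔
    ∃ k ∈ C, k.getD 0 0 = v ∧ supported L (assignment h v) (assignment h (k.getD 1 0))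
      (k.getD 2 0) (k.getD 3 0) = false := by
  simp [violates, assignment]

theorem assignment_improve (h : List ℕ) (v : ℕ) : assignment (improve (.range n) C L h) v =
    if v < n then assignment h v + (bif violates C L h v then 1 else 0) else 0 := by
  simp only [assignment, improve]
  split_ifs with hv
  · rw [List.getD_eq_getElem _ _ (by simpa using hv)]
    simp
  · rw [List.getD_eq_default _ _ (by simpa using hv)]

/-- If a vertex already sits at its position in the solution `g`, its partners are at or below
theirs, so `g` itself provides the support: such a vertex is never advanced. -/
theorem assignment_improve_le {h : List ℕ} {g : ℕ → ℕ} (hg : SatAll C L g)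
    (hle : ∀ v, assignment h v ≤ g v) (v : ℕ) :
    assignment (improve (.range n) C L h) v ≤ g v := by
  rw [assignment_improve]
  split_ifs with hv
  · cases hviol : violates C L h v with
    | false => simpa using hle v
    | true =>
      obtain ⟨k, hk, rfl, hs⟩ := violates_iff.1 hviol
      refine Nat.succ_le_of_lt ((hle _).lt_of_ne fun heq => ?_)
      rw [heq, (hg k hk).supported (hle _)] at hs
      exact absurd hs (by simp)
  · exact Nat.zero_le _

theorem satAll_of_not_violates (hC : ProperConstraints n C) {h : List ℕ}
    (hv : ∀ v < n, violates C L h v = false) : SatAll C L (assignment h) := by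
  have key : ∀ k ∈ C, supported L (assignment h (k.getD 0 0)) (assignment h (k.getD 1 0))
      (k.getD 2 0) (k.getD 3 0) = true := by
    intro k hk
    by_contra hs
    have h₁ := hv _ (hC.lt k hk)
    rw [violates_iff.2 ⟨k, hk, rfl, by simpa using hs⟩] at h₁
    exact absurd h₁ (by simp)
  exact fun k hk => sat_of_supported (hC.ne k hk) (key k hk) (key _ (hC.symm k hk))

theorem violates_congr {h h' : List ℕ} (hh : ∀ v, assignment h v = assignment h' v) (v : ℕ) :
    violates C L h v = violates C L h' v := by
  rw [Bool.eq_iff_iff, violates_iff, violates_iff]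
  simp only [hh]

/-- The sum of the positions is a potential: a round with a violation raises it, and a round without
one changes nothing ever after. -/
theorem le_sum_or_not_violates (k : ℕ) :
    k ≤ ∑ v ∈ Finset.range n, assignment ((improve (.range n) C L)^[k] []) v ∨
      ∀ v < n, violates C L ((improve (.range n) C L)^[k] []) v = false := by
  have hzero : ∀ k v, n ≤ v → assignment ((improve (.range n) C L)^[k] []) v = 0 := by
    intro k v hv
    cases k with
    | zero => simp [assignment]
    | succ k => simp [Function.iterate_succ_apply', assignment_improve, hv.not_gt]
  induction k with
  | zero => simp
  | succ k ih =>
    by_cases hviol : ∀ v < n, violates C L ((improve (.range n) C L)^[k] []) v = false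
    · right
      intro v hv
      rw [← hviol v hv, Function.iterate_succ_apply']
      -- The lists may differ, as the initial one is empty, but they assign the same positions
      -- because reading past the end gives 0.
      refine violates_congr (fun u => ?_) v
      rw [assignment_improve]
      split_ifs with hu
      · rw [hviol u hu]; rfl
      · exact (hzero k u (not_lt.1 hu)).symm
    · left
      refine Nat.succ_le_of_lt ((ih.resolve_right hviol).trans_lt ?_)
      push Not at hviol
      obtain ⟨v, hv, hv'⟩ := hviol
      rw [Function.iterate_succ_apply']
      refine Finset.sum_lt_sum (fun u hu => ?_) ⟨v, by simpa using hv, ?_⟩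
      · rw [assignment_improve, if_pos (by simpa using hu)]
        exact Nat.le_add_right _ _
      · rw [assignment_improve, if_pos hv, Bool.eq_true_of_not_eq_false hv']
        exact Nat.lt_succ_self _

theorem foldl_max_le_iff (l : List ℕ) (m t : ℕ) :
    l.foldl max m ≤ t ↔ m ≤ t ∧ ∀ v, assignment l v ≤ t := by
  have h : (∀ v, assignment l v ≤ t) ↔ ∀ x ∈ l, x ≤ t := by
    constructor
    · intro h x hx
      obtain ⟨i, hi, rfl⟩ := List.getElem_of_mem hx
      simpa [assignment, hi] using h i
    · intro h v
      by_cases hv : v < l.length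
      · rw [assignment, List.getD_eq_getElem _ _ hv]
        exact h _ (List.getElem_mem hv)
      · rw [assignment, List.getD_eq_default _ _ (not_lt.1 hv)]
        exact Nat.zero_le _
  rw [h]
  clear h
  induction l generalizing m with
  | nil => simp
  | cons a l ih => simp [ih, and_assoc]

/-- The list folded over in `leastHom` is only a clock; its entries are irrelevant. -/
theorem leastHom_eq (n : ℕ) (C L : List (List ℕ)) :
    leastHom (.range n) C L = (improve (.range n) C L)^[n * (L.length + 1)] [] := by
  rw [leastHom, List.foldl_const]
  simp [List.length_flatMap]

/-- If all positions are at most `t ≤ L.length` after `n * (L.length + 1)` rounds, the potential is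
too small for every round to have moved something, so the assignment is stable and hence a solution.
Conversely, any solution bounds the iteration from above. -/
theorem reach_le_iff (hn : 0 < n) (hC : ProperConstraints n C) {t : ℕ} (ht : t ≤ L.length) :
    reach (.range n) C L ≤ t ↔ ∃ g : ℕ → ℕ, (∀ v < n, g v ≤ t) ∧ SatAll C L g := by
  rw [reach, foldl_max_le_iff, leastHom_eq]
  constructor
  · rintro ⟨-, h⟩
    refine ⟨_, fun v _ => h v, satAll_of_not_violates hC
      ((le_sum_or_not_violates _).resolve_left fun hle => ?_)⟩
    have := hle.trans (Finset.sum_le_card_nsmul _ _ t fun v _ => h v)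
    simp only [Finset.card_range, smul_eq_mul] at this
    have := Nat.le_of_mul_le_mul_left this hn
    omega
  · rintro ⟨g, hg, hsat⟩
    have key : ∀ k v, assignment ((improve (.range n) C L)^[k] []) v ≤ g v := by
      intro k
      induction k with
      | zero => simp [assignment]
      | succ k ih =>
        rw [Function.iterate_succ_apply']
        exact assignment_improve_le hsat ih
    refine ⟨Nat.zero_le _, fun v => ?_⟩
    by_cases hv : v < n
    · exact (key _ v).trans (hg v hv)
    · have : n * (L.length + 1) ≠ 0 := by positivity
      obtain ⟨k, hk⟩ := Nat.exists_eq_succ_of_ne_zero this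
      rw [hk, Function.iterate_succ_apply', assignment_improve, if_neg hv]
      exact Nat.zero_le _

theorem SatAll.cons {g : ℕ → ℕ} (h : SatAll C L g) (e : List ℕ) :
    SatAll C (e :: L) (fun v => g v + 1) := fun k hk => by
  rcases h k hk with ⟨h₁, h₂⟩ | ⟨h₁, h₂⟩
  · exact .inl ⟨congrArg (· + 1) h₁, h₂⟩
  · exact .inr ⟨congrArg (· + 1) h₁, h₂⟩

theorem reach_cons_le (hn : 0 < n) (hC : ProperConstraints n C) (e : List ℕ)
    (h : reach (.range n) C L ≤ L.length) :
    reach (.range n) C (e :: L) ≤ reach (.range n) C L + 1 := by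
  obtain ⟨g, hg, hsat⟩ := (reach_le_iff hn hC h).1 le_rfl
  exact (reach_le_iff hn hC (by simpa using h)).2
    ⟨_, fun v hv => Nat.add_le_add_right (hg v hv) 1, hsat.cons e⟩

end PHom

namespace PHom

/-! ### Correctness of the computation of the probability -/

open Classical in
/-- The probability that a sequence of independent bits, which are true with the given
probabilities, has the property `P`. -/
noncomputable def listProb : List ℚ → (List Bool → Prop) → ℚ
  | [], P => if P [] then 1 else 0
  | p :: ps, P => p * listProb ps (fun w => P (true :: w)) +
      (1 - p) * listProb ps (fun w => P (false :: w))

theorem listProb_congr {ps : List ℚ} {P Q : List Bool → Prop}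
    (h : ∀ w, w.length = ps.length → (P w ↔ Q w)) : listProb ps P = listProb ps Q := by
  induction ps generalizing P Q with
  | nil =>
    have := h [] rfl
    by_cases hQ : Q [] <;> simp_all [listProb]
  | cons p ps ih =>
    rw [listProb, listProb, ih fun w hw => h (true :: w) (by simpa using hw),
      ih fun w hw => h (false :: w) (by simpa using hw)]

theorem listProb_true (ps : List ℚ) : listProb ps (fun _ => True) = 1 := by
  induction ps with
  | nil => simp [listProb]
  | cons p ps ih => simp [listProb, ih]

theorem listProb_false (ps : List ℚ) : listProb ps (fun _ => False) = 0 := by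
  induction ps with
  | nil => simp [listProb]
  | cons p ps ih => simp [listProb, ih]

theorem listProb_le_one {ps : List ℚ} (hps : ∀ p ∈ ps, 0 ≤ p ∧ p ≤ 1) (P : List Bool → Prop) :
    listProb ps P ≤ 1 := by
  induction ps generalizing P with
  | nil => simp only [listProb]; split_ifs <;> simp
  | cons p ps ih =>
    have h₁ := ih (fun q hq => hps q (by simp [hq])) fun w => P (true :: w)
    have h₂ := ih (fun q hq => hps q (by simp [hq])) fun w => P (false :: w)
    obtain ⟨h₃, h₄⟩ := hps p (by simp)
    rw [listProb]
    nlinarith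

section

variable (r : List (List ℕ) → ℕ)

/-- Some suffix of the path `L` begins with a run of kept edges that is as long as required
by `r`. -/
def Matches : List (List ℕ) → List Bool → Prop
  | [], _ => r [] = 0
  | e :: L, w => r (e :: L) ≤ L.length + 1 ∧ (∀ j < r (e :: L), w.getD j false = true) ∨
      Matches L w.tail

theorem matches_iff (L : List (List ℕ)) (w : List Bool) : Matches r L w ↔ ∃ i ≤ L.length,
    r (L.drop i) ≤ (L.drop i).length ∧ ∀ j < r (L.drop i), w.getD (i + j) false = true := by
  induction L generalizing w with
  | nil =>
    simp only [Matches, List.length_nil, Nat.le_zero, List.drop_nil]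
    constructor
    · exact fun h => ⟨0, rfl, h, by simp [h]⟩
    · rintro ⟨-, -, h, -⟩
      exact h
  | cons e L ih =>
    rw [Matches, ih]
    constructor
    · rintro (⟨h₁, h₂⟩ | ⟨i, hi, h₁, h₂⟩)
      · exact ⟨0, by simp, by simpa using h₁, by simpa using h₂⟩
      · refine ⟨i + 1, by simpa using hi, by simpa using h₁, fun j hj => ?_⟩
        have := h₂ j (by simpa using hj)
        cases w with
        | nil => simp at this
        | cons b w => rw [Nat.add_right_comm]; simpa using this
    · rintro ⟨i, hi, h₁, h₂⟩
      cases i with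
      | zero => exact .inl ⟨by simpa using h₁, by simpa using h₂⟩
      | succ i =>
        refine .inr ⟨i, by simpa using hi, by simpa using h₁, fun j hj => ?_⟩
        have := h₂ j (by simpa using hj)
        cases w with
        | nil => simp at this
        | cons b w => rw [Nat.add_right_comm] at this; simpa using this

variable {r}

/-- Going back from the suffix where a match starts, the required length grows by at most one per
added edge, so it still fits. -/
theorem Matches.le (hr : ∀ e L, r L ≤ L.length → r (e :: L) ≤ r L + 1) {L : List (List ℕ)}
    {w : List Bool} (h : Matches r L w) : r L ≤ L.length := by
  induction L generalizing w with
  | nil => exact le_of_eq h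
  | cons e L ih =>
    rcases h with ⟨h, -⟩ | h
    · exact h
    · have h₁ := ih h
      have h₂ := hr e L h₁
      simp
      omega

end

/-! ### The dynamic program over the suffixes of the path -/

/-- The probability of an edge given by numerator and denominator. -/
def stepProb (e : List ℕ) : ℚ := e.getD 1 0 / e.getD 2 0

theorem dp_reverse_cons (V : List ℕ) (C : List (List ℕ)) (e : List ℕ) (L : List (List ℕ)) :
    dp V C (e :: L).reverse = dpStep V C (dp V C L.reverse) e := by
  rw [dp, List.reverse_cons, List.foldl_append]; rfl

theorem dp_reverse_fst (V : List ℕ) (C : List (List ℕ)) (L : List (List ℕ)) :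
    (dp V C L.reverse).1 = L := by
  induction L with
  | nil => rfl
  | cons e L ih => rw [dp_reverse_cons, dpStep, ih]

/-- The steps of a path carry probabilities. -/
def ValidSteps (L : List (List ℕ)) : Prop := ∀ e ∈ L, 0 < e.getD 2 0 ∧ e.getD 1 0 ≤ e.getD 2 0

/-- The table is meaningful only for `k ≤ reach V C L`: then a match at the front already keeps the
first `k` edges and needs no separate treatment. At `k = reach V C L` the event is exactly that of a
match, which gives the last claim. -/
theorem dp_spec (V : List ℕ) (C : List (List ℕ))
    (hr : ∀ e L, reach V C L ≤ L.length → reach V C (e :: L) ≤ reach V C L + 1)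
    (L : List (List ℕ)) (hL : ValidSteps L) :
    0 < (dp V C L.reverse).2.headD 0 ∧
    (∀ k ≤ L.length, k ≤ reach V C L → ((dp V C L.reverse).2.getD k 0 : ℚ) =
      (dp V C L.reverse).2.headD 0 * listProb (L.map stepProb) fun w =>
        (∀ j < k, w.getD j false = true) ∨ Matches (reach V C) L w) ∧
    (dpValue V C (dp V C L.reverse) : ℚ) = (dp V C L.reverse).2.headD 0 *
      listProb (L.map stepProb) (Matches (reach V C) L) := by
  have key : ∀ L : List (List ℕ), (∀ k ≤ L.length, k ≤ reach V C L →
      ((dp V C L.reverse).2.getD k 0 : ℚ) =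
      (dp V C L.reverse).2.headD 0 * listProb (L.map stepProb) fun w =>
        (∀ j < k, w.getD j false = true) ∨ Matches (reach V C) L w) →
    (dpValue V C (dp V C L.reverse) : ℚ) = (dp V C L.reverse).2.headD 0 *
      listProb (L.map stepProb) (Matches (reach V C) L) := by
    intro L h
    rw [dpValue, dp_reverse_fst]
    by_cases hle : reach V C L ≤ L.length
    · rw [h _ hle le_rfl]
      congr 1
      refine listProb_congr fun w _ => ⟨fun hw => hw.elim (fun hw => ?_) id, .inr⟩
      exact (matches_iff _ _ _).2 ⟨0, Nat.zero_le _, by simpa using hle, by simpa using hw⟩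
    · have hlen := (dp_bounds V C L.reverse).2.1
      -- No homomorphism into the whole suffix: the look-up leaves the table, and the default 0 is
      -- the right probability.
      rw [List.getD_eq_default _ _ (by simp at hlen; omega)]
      have : listProb (L.map stepProb) (Matches (reach V C) L) = 0 := by
        rw [← listProb_false (L.map stepProb)]
        exact listProb_congr fun w _ => ⟨fun hw => hle (hw.le hr), False.elim⟩
      rw [this]
      simp
  induction L with
  | nil =>
    have h : ∀ k ≤ ([] : List (List ℕ)).length, k ≤ reach V C [] →
        ((dp V C ([] : List (List ℕ)).reverse).2.getD k 0 : ℚ) =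
        (dp V C ([] : List (List ℕ)).reverse).2.headD 0 * listProb ([].map stepProb) fun w =>
        (∀ j < k, w.getD j false = true) ∨ Matches (reach V C) [] w := by
      intro k hk _
      obtain rfl : k = 0 := by simpa using hk
      simp [dp, listProb]
    exact ⟨by simp [dp], h, key [] h⟩
  | cons e L ih =>
    obtain ⟨hpos, hX, hN⟩ := ih fun e he => hL e (by simp [he])
    obtain ⟨hq, hpq⟩ := hL e (by simp)
    have hlen := (dp_bounds V C L.reverse).2.1
    have hq' : (e.getD 2 0 : ℚ) ≠ 0 := by positivity
    have h : ∀ k ≤ (e :: L).length, k ≤ reach V C (e :: L) →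
        ((dp V C (e :: L).reverse).2.getD k 0 : ℚ) =
        (dp V C (e :: L).reverse).2.headD 0 * listProb ((e :: L).map stepProb) fun w =>
        (∀ j < k, w.getD j false = true) ∨ Matches (reach V C) (e :: L) w := by
      intro k hk hkr
      rw [dp_reverse_cons]
      cases k with
      | zero => simp [dpStep, dpRow, listProb_true]
      | succ k =>
        have hk' : k ≤ L.length := by simpa using hk
        -- This is where `hr` makes the entry for `k` in the shorter suffix available.
        have hkr' : k ≤ reach V C L := by
          by_cases hle : reach V C L ≤ L.length
          · have := hr e L hle
            omega
          · omega
        rw [List.map_cons, listProb]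
        -- With the first edge kept, a match at the front implies the run of `k + 1` edges, so only
        -- `k` further edges or a match in `L` matter.
        have h₁ : listProb (L.map stepProb) (fun w =>
          (∀ j < k + 1, (true :: w).getD j false = true) ∨
            Matches (reach V C) (e :: L) (true :: w)) = listProb (L.map stepProb) fun w =>
            (∀ j < k, w.getD j false = true) ∨ Matches (reach V C) L w := by
          refine listProb_congr fun w _ => ?_
          rw [Matches]
          constructor
          · rintro (h | ⟨-, h⟩ | h)
            · exact .inl fun j hj => by simpa using h (j + 1) (by omega)
            · exact .inl fun j hj => by simpa using h (j + 1) (by omega)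
            · exact .inr h
          · rintro (h | h)
            · refine .inl fun j hj => ?_
              cases j with
              | zero => rfl
              | succ j => simpa using h j (by omega)
            · exact .inr (.inr h)
        -- With the first edge lost, the run fails, and so does a match at the front, whose length
        -- is at least `k + 1 > 0`.
        have h₂ : listProb (L.map stepProb) (fun w =>
          (∀ j < k + 1, (false :: w).getD j false = true) ∨
            Matches (reach V C) (e :: L) (false :: w)) =
            listProb (L.map stepProb) (Matches (reach V C) L) := by
          refine listProb_congr fun w _ => ?_
          rw [Matches]
          constructor
          · rintro (h | ⟨-, h⟩ | h)
            · exact absurd (h 0 (by omega)) (by simp)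
            · exact absurd (h 0 (by omega)) (by simp)
            · exact h
          · exact fun h => .inr (.inr h)
        rw [h₁, h₂]
        have h₃ := hX k hk' hkr'
        have hk'' : k < (dp V C L.reverse).2.length := by simp at hlen; omega
        rw [List.getD_eq_getElem _ _ hk''] at h₃
        have h₄ : (dpStep V C (dp V C L.reverse) e).2.getD (k + 1) 0 = (e.getD 2 0 - e.getD 1 0) *
            dpValue V C (dp V C L.reverse) + e.getD 1 0 * (dp V C L.reverse).2[k] := by
          simp [dpStep, dpRow, hk'']
        have h₅ : (dpStep V C (dp V C L.reverse) e).2.headD 0 =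
          e.getD 2 0 * (dp V C L.reverse).2.headD 0 := rfl
        rw [h₄, h₅]
        -- The inequality `hpq` turns the truncated subtraction into the rational one.
        push_cast [hpq]
        rw [h₃, hN, stepProb]
        field_simp
        ring
    refine ⟨?_, h, key _ h⟩
    rw [dp_reverse_cons]
    exact Nat.mul_pos hq hpos

/-! ### Sums over subsets as probabilities of sequences of bits -/

theorem sum_fun_eq_listProb {m : ℕ} (p : Fin m → ℚ) (P : (Fin m → Bool) → Prop) [DecidablePred P] :
    ∑ f : Fin m → Bool, (if P f then ∏ i, (if f i = true then p i else 1 - p i) else 0) =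
      listProb (List.ofFn p) fun w => P fun i => w.getD i false := by
  classical
  induction m with
  | zero =>
    simp only [List.ofFn_zero, listProb]
    rw [Fintype.sum_unique, Finset.univ_eq_empty, Finset.prod_empty]
    congr!
  | succ m ih =>
    rw [← (Fin.consEquiv fun _ : Fin (m + 1) => Bool).sum_comp, Fintype.sum_prod_type,
      Fintype.sum_bool, List.ofFn_succ, listProb]
    have h : ∀ (b : Bool) (w : List Bool), (fun i : Fin (m + 1) => (b :: w).getD i false) =
        Fin.cons b fun i : Fin m => w.getD i false := by
      intro b w
      funext i
      refine Fin.cases ?_ (fun i => ?_) i <;> simp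
    simp only [h]
    rw [← ih _ fun f => P (Fin.cons true f), ← ih _ fun f => P (Fin.cons false f),
      Finset.mul_sum, Finset.mul_sum]
    congr 1 <;> refine Finset.sum_congr rfl fun f _ => ?_ <;>
      simp [Fin.consEquiv, Fin.prod_univ_succ]

theorem sum_finset_eq_listProb {E : Type} [Fintype E] [DecidableEq E] {m : ℕ} (e : Fin m ≃ E)
    (p : E → ℚ) (P : Finset E → Prop) [DecidablePred P] :
    ∑ S : Finset E with P S, (∏ x ∈ S, p x) * ∏ x ∈ Sᶜ, (1 - p x) =
      listProb (List.ofFn fun i => p (e i)) fun w =>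
        P (Finset.univ.filter fun x => w.getD (e.symm x) false = true) := by
  classical
  rw [← sum_fun_eq_listProb (fun i => p (e i))
    fun f => P (Finset.univ.filter fun x => f (e.symm x) = true), Finset.sum_filter]
  let φ : (Fin m → Bool) ≃ Finset E :=
    { toFun := fun f => Finset.univ.filter fun x => f (e.symm x) = true
      invFun := fun S i => decide (e i ∈ S)
      left_inv := fun f => by funext i; simp
      right_inv := fun S => by ext x; simp }
  rw [← φ.sum_comp]
  refine Finset.sum_congr rfl fun f _ => ?_
  have h : (∏ x ∈ φ f, p x) * ∏ x ∈ (φ f)ᶜ, (1 - p x) =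
      ∏ i, if f i = true then p (e i) else 1 - p (e i) := by
    rw [← e.symm.prod_comp, Finset.prod_ite]
    congr 1
    · exact Finset.prod_congr rfl fun x _ => by simp
    · refine Finset.prod_congr ?_ fun x _ => by simp
      ext x
      simp [φ]
  rw [h]
  rfl

end PHom

namespace PHom

/-! ### Correctness of the parser -/

theorem encodePosNum_eq_bits (p : PosNum) : Computability.encodePosNum p = (p : ℕ).bits := by
  induction p with
  | one => simp [Computability.encodePosNum]
  | bit0 p ih =>
    have : ((p.bit0 : PosNum) : ℕ) = 2 * (p : ℕ) := by simp [two_mul]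
    rw [this, Nat.bit0_bits _ p.cast_pos.ne', Computability.encodePosNum, ih]
  | bit1 p ih =>
    have : ((p.bit1 : PosNum) : ℕ) = 2 * (p : ℕ) + 1 := by simp [two_mul]
    rw [this, Nat.bit1_bits, Computability.encodePosNum, ih]

theorem encodeNat_eq_bits (n : ℕ) : Computability.encodeNat n = n.bits := by
  conv_rhs => rw [← Num.to_of_nat n]
  rw [Computability.encodeNat]
  cases (n : Num) with
  | zero => rfl
  | pos p => exact encodePosNum_eq_bits p

theorem foldr_bits (n : ℕ) : n.bits.foldr (fun b k => Nat.bit b k) 0 = n := by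
  induction n using Nat.binaryRec' with
  | zero => simp
  | bit b n hn ih => rw [Nat.bits_append_bit _ _ hn, List.foldr_cons, ih]

section

variable {σ : Type} (idx : σ → ℕ)

/-- The number of a label. -/
def labelCode (R : σ) : ℕ := 4 + idx R

/-- The number of a symbol. -/
def symbolCode : Symbol σ → ℕ
  | .comma => 0
  | .semicolon => 1
  | .bit b => 2 + b.toNat
  | .label R => labelCode idx R

/-- The parser, reading `w` from right to left. -/
def parseFrom (w : List (Symbol σ)) (acc : List (List ℕ)) : List (List ℕ) :=
  w.foldr (fun t acc => parseStep acc (symbolCode idx t)) acc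

theorem parse_reverse (w : List (Symbol σ)) :
    parse (w.map (symbolCode idx)).reverse = parseFrom idx w [] := by
  rw [parse, List.foldl_reverse, List.foldr_map, parseFrom]

theorem parseFrom_append (w w' : List (Symbol σ)) (acc : List (List ℕ)) :
    parseFrom idx (w ++ w') acc = parseFrom idx w (parseFrom idx w' acc) := by
  simp [parseFrom]

/-- The parser finds the numbers `t` in `w`. -/
def Parses (w : List (Symbol σ)) (t : List ℕ) : Prop :=
  ∀ s acc, parseFrom idx w (s :: acc) = (t ++ s) :: acc

variable {idx}

theorem Parses.nil : Parses idx [] [] := fun _ _ => rfl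

theorem Parses.append {w w' : List (Symbol σ)} {t t' : List ℕ} (h : Parses idx w t)
    (h' : Parses idx w' t') : Parses idx (w ++ w') (t ++ t') := fun s acc => by
  rw [parseFrom_append, h', h, List.append_assoc]

theorem Parses.flatMap {α : Type} {f : α → List (Symbol σ)} {g : α → List ℕ}
    (h : ∀ a, Parses idx (f a) (g a)) (l : List α) : Parses idx (l.flatMap f) (l.flatMap g) := by
  induction l with
  | nil => exact .nil
  | cons a l ih => exact (h a).append ih

theorem parses_label (R : σ) : Parses idx [.label R] [labelCode idx R] := fun s acc => by
  have h₁ : ¬ labelCode idx R = 0 := by simp [labelCode]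
  have h₂ : ¬ labelCode idx R = 1 := by simp [labelCode]; omega
  have h₃ : ¬ labelCode idx R ≤ 3 := by simp [labelCode]; omega
  simp [parseFrom, parseStep, symbolCode, h₁, h₂, h₃]

/-- Numbers are written with the least significant bit first and a final comma. Read from the right,
the comma opens a new number 0, and the bits then arrive from the most significant one on. -/
theorem parses_encodeNat (n : ℕ) : Parses idx (encodeNat n) [n] := fun s acc => by
  rw [encodeNat, encodeNat_eq_bits, parseFrom_append]
  have h₀ : parseFrom idx [.comma] (s :: acc) = (0 :: s) :: acc := rfl
  have h : ∀ (l : List Bool) (k : ℕ), parseFrom idx (l.map .bit) ((k :: s) :: acc) =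
      (l.foldr (fun b k => Nat.bit b k) k :: s) :: acc := by
    intro l k
    induction l with
    | nil => rfl
    | cons b l ih =>
      rw [parseFrom] at ih
      rw [parseFrom, List.map_cons, List.foldr_cons, ih]
      cases b <;> simp [parseStep, symbolCode]
  rw [h₀, h, foldr_bits]
  rfl

/-- The numbers that represent an edge. -/
def edgeNums {n : ℕ} (G : LabeledGraph (Fin n) σ) (idx : σ → ℕ) (annot : G.edges → List ℕ)
    (e : G.edges) : List ℕ :=
  [(e.1.1 : ℕ), (e.1.2 : ℕ), labelCode idx (G.label e)] ++ annot e

theorem parseFrom_encodeGraph {n : ℕ} (G : LabeledGraph (Fin n) σ)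
    {annot : G.edges → List (Symbol σ)} {annot' : G.edges → List ℕ}
    (h : ∀ e, Parses idx (annot e) (annot' e)) (acc : List (List ℕ)) :
    parseFrom idx (encodeGraph G annot) acc =
      List.range n :: G.edgeList.flatMap (edgeNums G idx annot') :: acc := by
  have h₁ := Parses.flatMap (idx := idx) (fun v : ℕ => parses_encodeNat v) (List.range n)
  have h₂ := Parses.flatMap (g := edgeNums G idx annot') (fun e : G.edges =>
    (((parses_encodeNat (e.1.1 : ℕ)).append (parses_encodeNat (e.1.2 : ℕ))).append
      (parses_label (G.label e))).append (h e)) G.edgeList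
  have h₀ : ∀ acc, parseFrom idx [.semicolon] acc = [] :: acc := fun _ => rfl
  -- In `encodeGraph` the vertex list is coerced from `List (Fin n)` to `List ℕ` through the list
  -- monad.
  have h₃ : (do let a ← List.finRange n; pure (a : ℕ)) = List.range n := by
    rw [← List.map_coe_finRange_eq_range]
    exact (List.map_eq_flatMap ..).symm
  rw [encodeGraph, h₃, parseFrom_append, parseFrom_append, parseFrom_append, h₀ acc, h₂, h₀, h₁]
  simp [List.flatMap_singleton']

theorem parses_encodeFraction (q : ProbFraction) :
    Parses idx (encodeFraction q) [q.num, q.den] :=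
  (parses_encodeNat q.num).append (parses_encodeNat q.den)

theorem parse_encodeInput {𝒢 ℋ : GraphClass σ} (x : Input 𝒢 ℋ) :
    parse ((encodeInput x).map (symbolCode idx)).reverse =
      [List.range x.nG, x.G.edgeList.flatMap (edgeNums x.G idx fun _ => []),
        List.range x.nH, x.H.edgeList.flatMap
          (edgeNums x.H idx fun e => [(x.prob e).num, (x.prob e).den])] := by
  rw [parse_reverse, encodeInput, parseFrom_append,
    parseFrom_encodeGraph x.H fun e => parses_encodeFraction (x.prob e),
    parseFrom_encodeGraph x.G fun _ => .nil]

end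

/-- As all finished pieces are full, the last element of `y` opens a new piece, and the others join
it because it is not yet full. -/
theorem foldr_chunkStep {k : ℕ} {acc : List (List ℕ)} (hacc : ∀ y ∈ acc, y.length = k)
    (y : List ℕ) (hy : y ≠ []) (hyk : y.length ≤ k) :
    y.foldr (fun t acc => chunkStep k acc t) acc = y :: acc := by
  induction y with
  | nil => exact absurd rfl hy
  | cons t y ih =>
    rw [List.foldr_cons]
    rcases eq_or_ne y [] with rfl | hy'
    · cases acc with
      | nil => rfl
      | cons z acc => simp [chunkStep, hacc z]
    · rw [ih hy' (by simp at hyk; omega)]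
      have : y.length ≠ k := by simp at hyk; omega
      simp [chunkStep, this]

theorem chunk_flatMap {α : Type} {k : ℕ} (hk : k ≠ 0) (f : α → List ℕ)
    (hf : ∀ a, (f a).length = k) (l : List α) : chunk k (l.flatMap f) = l.map f := by
  rw [chunk, List.foldl_reverse]
  induction l with
  | nil => rfl
  | cons a l ih =>
    rw [List.flatMap_cons, List.foldr_append, ih, List.map_cons]
    refine foldr_chunkStep (fun y hy => ?_) _ (fun h => ?_) (hf a).le
    · obtain ⟨b, -, rfl⟩ := List.mem_map.1 hy
      exact hf b
    · have := hf a
      simp [h] at this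
      omega

theorem mem_edgeList {σ : Type} {n : ℕ} (G : LabeledGraph (Fin n) σ) (e : G.edges) :
    e ∈ G.edgeList := by
  rw [LabeledGraph.edgeList, List.mem_filterMap]
  exact ⟨e.1, List.pair_mem_product.2 ⟨List.mem_finRange _, List.mem_finRange _⟩, by simp⟩

theorem nodup_edgeList {σ : Type} {n : ℕ} (G : LabeledGraph (Fin n) σ) : G.edgeList.Nodup := by
  refine List.Nodup.filterMap (fun a a' b hb hb' => ?_) (List.Nodup.product (List.nodup_finRange n)
    (List.nodup_finRange n))
  simp only [Option.mem_def, Option.dite_none_right_eq_some, Option.some.injEq] at hb hb'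
  obtain ⟨_, rfl⟩ := hb
  obtain ⟨_, h⟩ := hb'
  exact (congrArg Subtype.val h).symm

end PHom

namespace PHom

/-! ### The constraints of a query graph -/

theorem sat_symm {L : List (List ℕ)} {x y c c' : ℕ} : Sat L x y c c' ↔ Sat L y x c' c := Or.comm

section

variable {σ : Type} {n : ℕ} (G : LabeledGraph (Fin n) σ) (idx : σ → ℕ)

/-- The constraints of the graph `G`. -/
def graphConstraints : List (List ℕ) :=
  constraints (G.edgeList.map (edgeNums G idx fun _ => []))

theorem mem_graphConstraints {k : List ℕ} : k ∈ graphConstraints G idx ↔ ∃ e : G.edges,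
    k = [(e.1.1 : ℕ), (e.1.2 : ℕ), labelCode idx (G.label e) + labelCode idx (G.label e),
      labelCode idx (G.label e) + labelCode idx (G.label e) + 1] ∨
    k = [(e.1.2 : ℕ), (e.1.1 : ℕ), labelCode idx (G.label e) + labelCode idx (G.label e) + 1,
      labelCode idx (G.label e) + labelCode idx (G.label e)] := by
  simp [graphConstraints, constraints, edgeNums, mem_edgeList]

theorem properConstraints : ProperConstraints n (graphConstraints G idx) where
  lt k hk := by
    obtain ⟨e, rfl | rfl⟩ := (mem_graphConstraints G idx).1 hk
    exacts [e.1.1.2, e.1.2.2]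
  ne k hk := by
    obtain ⟨e, rfl | rfl⟩ := (mem_graphConstraints G idx).1 hk <;> simp
  symm k hk := by
    obtain ⟨e, rfl | rfl⟩ := (mem_graphConstraints G idx).1 hk
    exacts [(mem_graphConstraints G idx).2 ⟨e, .inr rfl⟩,
      (mem_graphConstraints G idx).2 ⟨e, .inl rfl⟩]

theorem satAll_graphConstraints {L : List (List ℕ)} {g : ℕ → ℕ} :
    SatAll (graphConstraints G idx) L g ↔ ∀ e : G.edges, Sat L (g e.1.1) (g e.1.2)
      (labelCode idx (G.label e) + labelCode idx (G.label e))
      (labelCode idx (G.label e) + labelCode idx (G.label e) + 1) := by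
  constructor
  · exact fun h e => h _ ((mem_graphConstraints G idx).2 ⟨e, .inl rfl⟩)
  · intro h k hk
    obtain ⟨e, rfl | rfl⟩ := (mem_graphConstraints G idx).1 hk
    exacts [h e, sat_symm.1 (h e)]

end

end PHom

namespace PHom

/-! ### Positions on a two-way path -/

/-- `pos` numbers the vertices of the two-way path `H` from one end to the other. -/
structure IsPathNumbering {V σ : Type} (H : LabeledGraph V σ) (m : ℕ) (pos : V → ℕ) : Prop where
  injective : Function.Injective pos
  le : ∀ v, pos v ≤ m
  surj : ∀ i ≤ m, ∃ v, pos v = i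
  adj : ∀ e : H.edges, pos e.1.2 = pos e.1.1 + 1 ∨ pos e.1.1 = pos e.1.2 + 1
  edge : ∀ i < m, ∃! e : H.edges, min (pos e.1.1) (pos e.1.2) = i

theorem LabeledGraph.IsTwoWayPath.exists_isPathNumbering {V σ : Type} {H : LabeledGraph V σ}
    (hH : H.IsTwoWayPath) : ∃ m pos, IsPathNumbering H m pos := by
  obtain ⟨m, a, ha, hxor, hE⟩ := hH
  let b := Equiv.ofBijective a ha
  have hb : ∀ i, ((b.symm (a i) : Fin (m + 1)) : ℕ) = i := fun i => by
    rw [show a i = b i from rfl, b.symm_apply_apply]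
  have hmin : ∀ (e : H.edges) (i : Fin m),
      min (b.symm e.1.1 : ℕ) (b.symm e.1.2) = i →
        e.1 = (a i.castSucc, a i.succ) ∨ e.1 = (a i.succ, a i.castSucc) := by
    intro e i h
    obtain ⟨j, hj⟩ := hE e.1 e.2
    have : j = i := by
      apply Fin.ext
      rw [← h]
      rcases hj with hj | hj <;> rw [hj] <;> simp [hb]
    exact this ▸ hj
  refine ⟨m, fun v => b.symm v, ⟨fun u v h => b.symm.injective (Fin.ext h),
    fun v => Nat.le_of_lt_succ (b.symm v).2, fun i hi => ⟨a ⟨i, Nat.lt_succ_of_le hi⟩, hb _⟩,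
    fun e => ?_, fun i hi => ?_⟩⟩
  · obtain ⟨j, hj | hj⟩ := hE e.1 e.2 <;> rw [hj] <;> simp [hb]
  · rcases hxor ⟨i, hi⟩ with ⟨h, h'⟩ | ⟨h, h'⟩
    · refine ⟨⟨_, h⟩, by simp [hb], fun e he => ?_⟩
      rcases hmin e ⟨i, hi⟩ he with h₁ | h₁
      · exact Subtype.ext h₁
      · exact absurd (h₁ ▸ e.2) h'
    · refine ⟨⟨_, h⟩, by simp [hb], fun e he => ?_⟩
      rcases hmin e ⟨i, hi⟩ he with h₁ | h₁
      · exact absurd (h₁ ▸ e.2) h'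
      · exact Subtype.ext h₁

namespace IsPathNumbering

section

variable {V σ : Type} {H : LabeledGraph V σ} {m : ℕ} {pos : V → ℕ}

/-- The walk may start at either end of the path; reversing the numbering lets it start at 0. -/
theorem rev (h : IsPathNumbering H m pos) : IsPathNumbering H m fun v => m - pos v where
  injective u v huv := h.injective (by have := h.le u; have := h.le v; simp only at huv; omega)
  le v := Nat.sub_le _ _
  surj i hi := by
    obtain ⟨v, hv⟩ := h.surj (m - i) (Nat.sub_le _ _)
    exact ⟨v, by omega⟩
  adj e := by
    have := h.le e.1.1
    have := h.le e.1.2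
    have := h.adj e
    omega
  edge i hi := by
    have key : ∀ e : H.edges, min (m - pos e.1.1) (m - pos e.1.2) = i ↔
        min (pos e.1.1) (pos e.1.2) = m - 1 - i := by
      intro e
      have := h.le e.1.1
      have := h.le e.1.2
      have := h.adj e
      omega
    simp only [key]
    exact h.edge _ (by omega)

/-- The edge number of an edge of a path. -/
noncomputable def edgeEquiv (h : IsPathNumbering H m pos) : H.edges ≃ Fin m :=
  Equiv.ofBijective (fun e => ⟨min (pos e.1.1) (pos e.1.2), by
    have := h.le e.1.1
    have := h.le e.1.2
    have := h.adj e
    omega⟩) ⟨fun e f hef => by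
      have hef' := congrArg Fin.val hef
      refine (h.edge (min (pos e.1.1) (pos e.1.2)) ?_).unique rfl hef'.symm
      have := h.le e.1.1
      have := h.le e.1.2
      have := h.adj e
      omega, fun i => by
      obtain ⟨e, he, -⟩ := h.edge i i.2
      exact ⟨e, Fin.ext he⟩⟩

variable (h : IsPathNumbering H m pos)
include h

theorem edgeEquiv_val (e : H.edges) : (h.edgeEquiv e : ℕ) = min (pos e.1.1) (pos e.1.2) := rfl

theorem ends (e : H.edges) :
    pos e.1.1 = h.edgeEquiv e ∧ pos e.1.2 = h.edgeEquiv e + 1 ∨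
      pos e.1.2 = h.edgeEquiv e ∧ pos e.1.1 = h.edgeEquiv e + 1 := by
  rw [edgeEquiv_val]
  have := h.adj e
  omega

theorem edge_ext {e f : H.edges} (hef : (h.edgeEquiv e : ℕ) = h.edgeEquiv f) : e = f :=
  h.edgeEquiv.injective (Fin.ext hef)

theorem mem_edge_iff (e : H.edges) (v : V) : e.1.1 = v ∨ e.1.2 = v ↔
    pos v = h.edgeEquiv e ∨ pos v = h.edgeEquiv e + 1 := by
  rw [← h.injective.eq_iff, ← h.injective.eq_iff (a := e.1.2)]
  have := h.ends e
  omega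

end

section

variable {n m : ℕ} {σ : Type} {H : LabeledGraph (Fin n) σ} {pos : Fin n → ℕ}
  (h : IsPathNumbering H m pos) (idx : σ → ℕ) (annot : H.edges → List ℕ)
include h

theorem incident_edgeNums (e : H.edges) (v : Fin n) :
    incident v (edgeNums H idx annot e) = true ↔
      pos v = h.edgeEquiv e ∨ pos v = h.edgeEquiv e + 1 := by
  rw [← h.mem_edge_iff e v]
  simp [incident, edgeNums, Fin.ext_iff]

/-- An inner vertex at position `i` lies on the two edges numbered `i - 1` and `i`. -/
theorem degree_le_one_iff (v : Fin n) :
    ((H.edgeList.map (edgeNums H idx annot)).filter (incident v)).length ≤ 1 ↔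
      pos v = 0 ∨ pos v = m := by
  classical
  rw [List.filter_map, List.length_map,
    ← List.toFinset_card_of_nodup ((nodup_edgeList H).filter _), Finset.card_le_one]
  simp only [List.mem_toFinset, List.mem_filter, mem_edgeList, true_and, Function.comp_apply,
    h.incident_edgeNums]
  constructor
  · intro hv
    by_contra! hne
    have hle := h.le v
    have h₁ := hv (h.edgeEquiv.symm ⟨pos v - 1, by omega⟩) (by simp; omega)
      (h.edgeEquiv.symm ⟨pos v, by omega⟩) (by simp)
    have h₂ := congrArg Fin.val (h.edgeEquiv.symm.injective h₁)
    simp only at h₂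
    omega
  · intro hv e he f hf
    apply h.edge_ext
    have := (h.edgeEquiv e).2
    have := (h.edgeEquiv f).2
    omega

theorem pathEnd_eq : ∃ v : Fin n,
    pathEnd (.range n) (H.edgeList.map (edgeNums H idx annot)) = v ∧ (pos v = 0 ∨ pos v = m) := by
  obtain ⟨v₀, hv₀⟩ := h.surj 0 (Nat.zero_le _)
  have hne : (List.range n).filter (fun v => decide
      (((H.edgeList.map (edgeNums H idx annot)).filter (incident v)).length ≤ 1)) ≠ [] := by
    refine List.ne_nil_of_mem (a := (v₀ : ℕ)) (List.mem_filter.2 ⟨by simp, ?_⟩)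
    exact decide_eq_true ((h.degree_le_one_iff idx annot v₀).2 (.inl hv₀))
  have hmem := List.head_mem hne
  rw [List.mem_filter, List.mem_range, decide_eq_true_iff] at hmem
  refine ⟨⟨_, hmem.1⟩, ?_, (h.degree_le_one_iff idx annot ⟨_, hmem.1⟩).1 hmem.2⟩
  rw [pathEnd, List.headD_eq_head?_getD, List.head?_eq_some_head hne, Option.getD_some]

end

end IsPathNumbering

theorem headD_filter_eq {β : Type} {l : List β} {p : β → Bool} {b : β} (d : β) (hb : b ∈ l)
    (hp : p b = true) (hl : ∀ x ∈ l, p x = true → x = b) : (l.filter p).headD d = b := by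
  have hne : l.filter p ≠ [] := List.ne_nil_of_mem (List.mem_filter.2 ⟨hb, hp⟩)
  have hmem := List.mem_filter.1 (List.head_mem hne)
  rw [List.headD_eq_head?_getD, List.head?_eq_some_head hne, Option.getD_some]
  exact hl _ hmem.1 hmem.2

section

variable {n m : ℕ} {σ : Type} {H : LabeledGraph (Fin n) σ}

/-- The step of a walk along the edge `e`. -/
def pathStep (H : LabeledGraph (Fin n) σ) (idx : σ → ℕ) (pos : Fin n → ℕ)
    (q : H.edges → ProbFraction) (e : H.edges) : List ℕ :=
  [if pos e.1.1 < pos e.1.2 then labelCode idx (H.label e) + labelCode idx (H.label e)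
    else labelCode idx (H.label e) + labelCode idx (H.label e) + 1, (q e).num, (q e).den]

/-- The steps of the walk along a path. -/
noncomputable def pathSteps {pos : Fin n → ℕ} (h : IsPathNumbering H m pos) (idx : σ → ℕ)
    (q : H.edges → ProbFraction) : List (List ℕ) :=
  List.ofFn fun i => pathStep H idx pos q (h.edgeEquiv.symm i)

variable {pos : Fin n → ℕ} (h : IsPathNumbering H m pos) (idx : σ → ℕ)
  (q : H.edges → ProbFraction)

/-- At the start the previous vertex is the dummy `n`, which lies on no edge, so nothing is
excluded. Later it excludes the edge just traversed. -/
theorem nextEdge_eq {e : H.edges} {v : Fin n} {u : ℕ} (hv : pos v = h.edgeEquiv e)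
    (hu : pos v = 0 ∧ u = n ∨ ∃ y : Fin n, u = y ∧ pos y + 1 = pos v) :
    nextEdge (H.edgeList.map (edgeNums H idx fun e => [(q e).num, (q e).den])) v u =
      edgeNums H idx (fun e => [(q e).num, (q e).den]) e := by
  have hinc : ∀ f : H.edges,
      incident u (edgeNums H idx (fun e => [(q e).num, (q e).den]) f) = true ↔
        pos v = h.edgeEquiv f + 1 ∨ pos v = h.edgeEquiv f + 2 := by
    intro f
    rcases hu with ⟨h₀, rfl⟩ | ⟨y, rfl, hy⟩
    · have h₁ := f.1.1.2.ne
      have h₂ := f.1.2.2.ne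
      simp [incident, edgeNums, h₀, h₁, h₂]
    · rw [h.incident_edgeNums]
      omega
  refine headD_filter_eq _ (List.mem_map_of_mem (mem_edgeList H e)) ?_ fun x hx hp => ?_
  · have h₁ := (h.incident_edgeNums idx (fun e => [(q e).num, (q e).den]) e v).2 (.inl hv)
    have h₂ := (hinc e).not.2 (by omega)
    simp [h₁, h₂]
  · obtain ⟨f, -, rfl⟩ := List.mem_map.1 hx
    rw [Bool.and_eq_true, Bool.not_eq_true', ← Bool.not_eq_true, hinc,
      h.incident_edgeNums] at hp
    rw [h.edge_ext (e := f) (f := e) (by omega)]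

theorem walk_iterate {v₀ : Fin n} (h₀ : pos v₀ = 0) (k : ℕ) (hk : k ≤ m) :
    ∃ (v : Fin n) (u : ℕ), pos v = k ∧
      (pos v = 0 ∧ u = n ∨ ∃ y : Fin n, u = y ∧ pos y + 1 = pos v) ∧
      (walkStep (H.edgeList.map (edgeNums H idx fun e => [(q e).num, (q e).den])))^[k]
        (((v₀ : ℕ), n), []) = (((v : ℕ), u), ((pathSteps h idx q).take k).reverse) := by
  induction k with
  | zero => exact ⟨v₀, n, h₀, .inl ⟨h₀, rfl⟩, rfl⟩
  | succ k ih =>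
    obtain ⟨v, u, hv, hu, hs⟩ := ih (by omega)
    obtain ⟨e, he⟩ : ∃ e, e = h.edgeEquiv.symm ⟨k, hk⟩ := ⟨_, rfl⟩
    have he' : (h.edgeEquiv e : ℕ) = k := by simp [he]
    have hlen : k < (pathSteps h idx q).length := by rw [pathSteps, List.length_ofFn]; omega
    have htake : ((pathSteps h idx q).take (k + 1)).reverse =
        pathStep H idx pos q e :: ((pathSteps h idx q).take k).reverse := by
      rw [List.take_succ_eq_append_getElem hlen, List.reverse_append, he]
      simp [pathSteps]
    rw [Function.iterate_succ_apply', hs, htake, walkStep]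
    simp only [nextEdge_eq h idx q (hv.trans he'.symm) hu]
    rcases h.ends e with ⟨h₁, h₂⟩ | ⟨h₁, h₂⟩
    · obtain rfl : e.1.1 = v := h.injective (by omega)
      refine ⟨e.1.2, e.1.1, by omega, .inr ⟨e.1.1, rfl, by omega⟩, ?_⟩
      simp [edgeNums, pathStep, h₁, h₂]
    · obtain rfl : e.1.2 = v := h.injective (by omega)
      -- The direction is detected by comparing the source with the current vertex, which is sound
      -- because a path has no loops.
      have hne : (e.1.1 : ℕ) ≠ e.1.2 := fun hne => by
        have := congrArg pos (Fin.ext hne)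
        omega
      refine ⟨e.1.1, e.1.2, by omega, .inr ⟨e.1.2, rfl, by omega⟩, ?_⟩
      simp [edgeNums, pathStep, h₁, h₂, hne]

end

theorem exists_walk_eq {n : ℕ} {σ : Type} {H : LabeledGraph (Fin n) σ} (hH : H.IsTwoWayPath)
    (idx : σ → ℕ) (q : H.edges → ProbFraction) : ∃ (m : ℕ) (pos : Fin n → ℕ)
      (h : IsPathNumbering H m pos),
      walk (.range n) (H.edgeList.map (edgeNums H idx fun e => [(q e).num, (q e).den])) =
        (pathSteps h idx q).reverse := by
  obtain ⟨m, pos, h⟩ := hH.exists_isPathNumbering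
  obtain ⟨v, hv, hpos⟩ := h.pathEnd_eq idx fun e => [(q e).num, (q e).den]
  obtain ⟨pos, h, h₀⟩ : ∃ pos, IsPathNumbering H m pos ∧ pos v = 0 := by
    rcases hpos with hpos | hpos
    · exact ⟨pos, h, hpos⟩
    · exact ⟨_, h.rev, by omega⟩
  refine ⟨m, pos, h, ?_⟩
  have hm : H.edgeList.length = m := by
    classical
    rw [← List.toFinset_card_of_nodup (nodup_edgeList H),
      show H.edgeList.toFinset = Finset.univ from
        Finset.eq_univ_of_forall fun e => List.mem_toFinset.2 (mem_edgeList H e),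
      Finset.card_univ, Fintype.card_congr h.edgeEquiv, Fintype.card_fin]
  obtain ⟨_, _, -, -, hs⟩ := walk_iterate h idx q h₀ m le_rfl
  rw [walk, List.foldl_const, hv, List.length_map, List.length_range, hm, hs]
  rw [List.take_of_length_le (by rw [pathSteps, List.length_ofFn])]

end PHom

namespace PHom

/-! ### Homomorphisms from connected graphs to two-way paths -/

theorem LabeledGraph.isHom_subgraph_iff {V W σ : Type} {G : LabeledGraph V σ}
    {H : LabeledGraph W σ} {E' : Finset H.edges} {g : V → W} : G.IsHom (H.subgraph E') g ↔
    ∀ e : G.edges, ∃ f ∈ E', f.1 = (g e.1.1, g e.1.2) ∧ H.label f = G.label e := by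
  refine forall_congr' fun e => ⟨?_, ?_⟩
  · rintro ⟨he, hl⟩
    obtain ⟨f, hf, hfe⟩ := Finset.mem_map.1 he
    exact ⟨f, hf, hfe, by rw [← hl]; exact congrArg H.label (Subtype.ext hfe)⟩
  · rintro ⟨f, hf, hfe, hl⟩
    have he : (g e.1.1, g e.1.2) ∈ (H.subgraph E').edges := Finset.mem_map.2 ⟨f, hf, hfe⟩
    exact ⟨he, by rw [← hl]; exact congrArg H.label (Subtype.ext hfe.symm)⟩

theorem LabeledGraph.IsConnected.exists_edge_boundary {V σ : Type} {G : LabeledGraph V σ}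
    (hG : G.IsConnected) {S : Set V} {u v : V} (hu : u ∈ S) (hv : v ∉ S) :
    ∃ e : G.edges, e.1.1 ∈ S ∧ e.1.2 ∉ S ∨ e.1.2 ∈ S ∧ e.1.1 ∉ S := by
  obtain ⟨p⟩ := hG.preconnected u v
  obtain ⟨d, -, h₁, h₂⟩ := p.exists_boundary_dart S hu hv
  obtain ⟨-, hd | hd⟩ := (SimpleGraph.fromRel_adj _ _ _).1 d.adj
  exacts [⟨⟨_, hd⟩, .inl ⟨h₁, h₂⟩⟩, ⟨⟨_, hd⟩, .inr ⟨h₁, h₂⟩⟩]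

theorem codeAt_drop (L : List (List ℕ)) (i x : ℕ) : codeAt (L.drop i) x = codeAt L (i + x) := by
  simp [codeAt, List.getD_eq_getElem?_getD]

theorem sat_drop {L : List (List ℕ)} {i x y c c' : ℕ} :
    Sat (L.drop i) x y c c' ↔ Sat L (i + x) (i + y) c c' := by
  simp only [Sat, codeAt_drop]
  refine or_congr (and_congr_left' ?_) (and_congr_left' ?_) <;> omega

section

variable {n m : ℕ} {σ : Type} {H : LabeledGraph (Fin n) σ} {pos : Fin n → ℕ}
  (h : IsPathNumbering H m pos) {idx : σ → ℕ} (q : H.edges → ProbFraction)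

theorem length_pathSteps : (pathSteps h idx q).length = m := List.length_ofFn

theorem codeAt_pathSteps (e : H.edges) : codeAt (pathSteps h idx q) (h.edgeEquiv e) =
    if pos e.1.1 < pos e.1.2 then labelCode idx (H.label e) + labelCode idx (H.label e)
      else labelCode idx (H.label e) + labelCode idx (H.label e) + 1 := by
  rw [codeAt, List.getD_eq_getElem _ _ (by rw [length_pathSteps]; exact (h.edgeEquiv e).2)]
  simp [pathSteps, pathStep]

theorem exists_edge_of_codeAt {x : ℕ} (hx : codeAt (pathSteps h idx q) x ≠ 0) :
    ∃ e : H.edges, x = h.edgeEquiv e := by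
  refine ⟨h.edgeEquiv.symm ⟨x, ?_⟩, by simp⟩
  by_contra hlt
  rw [codeAt, List.getD_eq_default _ _ (by rw [length_pathSteps]; omega)] at hx
  exact hx rfl

/-- The parity of a code records the direction of the edge and its half the label. Label codes are
at least 4, so the default 0 beyond the end of the path matches no constraint. -/
theorem sat_pathSteps_iff (hidx : Function.Injective idx) {x y : ℕ} {R : σ} :
    Sat (pathSteps h idx q) x y (labelCode idx R + labelCode idx R)
      (labelCode idx R + labelCode idx R + 1) ↔
    ∃ e : H.edges, pos e.1.1 = x ∧ pos e.1.2 = y ∧ H.label e = R := by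
  have hcode : labelCode idx R ≠ 0 := by simp [labelCode]
  constructor
  · rintro (⟨rfl, hc⟩ | ⟨rfl, hc⟩)
    all_goals
      obtain ⟨e, rfl⟩ := exists_edge_of_codeAt h q (hc.trans_ne (by omega))
      rw [codeAt_pathSteps] at hc
      have hends := h.ends e
      have hl : labelCode idx (H.label e) = labelCode idx R := by split_ifs at hc <;> omega
      refine ⟨e, ?_, ?_, hidx (Nat.add_left_cancel hl)⟩ <;> split_ifs at hc <;> omega
  · rintro ⟨e, rfl, rfl, rfl⟩
    have hc := codeAt_pathSteps h (idx := idx) q e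
    rcases h.ends e with ⟨h₁, h₂⟩ | ⟨h₁, h₂⟩
    · exact .inl ⟨by omega, by rw [h₁, hc, if_pos (by omega)]⟩
    · exact .inr ⟨by omega, by rw [h₁, hc, if_neg (by omega)]⟩

/-- Connectivity enters in one direction only: the image of a connected graph contains all edges
between its extreme positions, and these include the run required at the lowest one. Conversely, a
kept run carries the least homomorphism into the suffix starting there. -/
theorem homTo_subgraph_iff {nG : ℕ} {G : LabeledGraph (Fin nG) σ} (hnG : 0 < nG)
    (hG : G.IsConnected) (hidx : Function.Injective idx) (w : List Bool) :
    G.HomTo (H.subgraph (Finset.univ.filter fun e => w.getD (h.edgeEquiv e) false = true)) ↔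
      Matches (reach (.range nG) (graphConstraints G idx)) (pathSteps h idx q) w := by
  have hC := properConstraints G idx
  simp only [matches_iff, LabeledGraph.HomTo, LabeledGraph.isHom_subgraph_iff, Finset.mem_filter,
    Finset.mem_univ, true_and, List.length_drop, length_pathSteps]
  constructor
  · rintro ⟨f, hf⟩
    have : Nonempty (Fin nG) := ⟨⟨0, hnG⟩⟩
    obtain ⟨u, hu⟩ := Finite.exists_min fun v => pos (f v)
    obtain ⟨v, hv⟩ := Finite.exists_max fun v => pos (f v)
    have hvm := h.le (f v)
    have huv := hu v
    -- Translating the homomorphism so that its lowest position becomes 0 gives a competitor for the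
    -- least one.
    have hr : reach (.range nG) (graphConstraints G idx) ((pathSteps h idx q).drop (pos (f u))) ≤
        pos (f v) - pos (f u) := by
      refine (reach_le_iff hnG hC (by rw [List.length_drop, length_pathSteps]; omega)).2
        ⟨fun x => if hx : x < nG then pos (f ⟨x, hx⟩) - pos (f u) else 0, fun x hx => ?_, ?_⟩
      · simp only [dif_pos hx]
        exact Nat.sub_le_sub_right (hv _) _
      · rw [satAll_graphConstraints]
        intro e
        obtain ⟨a, -, ha, hl⟩ := hf e
        have h₁ := hu e.1.1
        have h₂ := hu e.1.2
        simp only [Fin.is_lt, Fin.eta, dite_true]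
        rw [sat_drop, Nat.add_sub_cancel' h₁, Nat.add_sub_cancel' h₂,
          sat_pathSteps_iff h q hidx]
        exact ⟨a, by rw [ha], by rw [ha], hl⟩
    refine ⟨pos (f u), by omega, by omega, fun j hj => ?_⟩
    -- Cut `G` after position `pos (f u) + j`. The image of an edge across the cut can only be the
    -- path edge with this number, so that edge is kept.
    obtain ⟨e, he⟩ := hG.exists_edge_boundary (S := {x | pos (f x) ≤ pos (f u) + j})
      (u := u) (v := v) (by simp) (by simp; omega)
    simp only [Set.mem_ofPred_eq] at he
    obtain ⟨a, hw, ha, -⟩ := hf e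
    have hends := h.ends a
    rw [ha] at hends
    simp only at hends
    rwa [show pos (f u) + j = h.edgeEquiv a by omega]
  · rintro ⟨i, hi, hr, hw⟩
    obtain ⟨g, hg, hsat⟩ := (reach_le_iff hnG hC (by rwa [List.length_drop, length_pathSteps])).1
      le_rfl
    rw [satAll_graphConstraints] at hsat
    choose f hf using fun v : Fin nG => h.surj (i + g v) (by have := hg v v.2; omega)
    refine ⟨f, fun e => ?_⟩
    obtain ⟨a, h₁, h₂, hl⟩ := (sat_pathSteps_iff h q hidx).1 (sat_drop.1 (hsat e))
    refine ⟨a, ?_, Prod.ext (h.injective (h₁.trans (hf _).symm))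
      (h.injective (h₂.trans (hf _).symm)), hl⟩
    -- Both ends lie between `i` and `i` plus the reach, so the edge between them belongs to the
    -- kept run.
    have hg₁ := hg e.1.1 e.1.1.2
    have hg₂ := hg e.1.2 e.1.2.2
    have hends := h.ends a
    have := hw (h.edgeEquiv a - i) (by omega)
    rwa [Nat.add_sub_cancel' (by omega)] at this

end

end PHom

namespace PHom

/-! ### Correctness of the algorithm -/

section

variable {σ : Type} {idx : σ → ℕ} {x : Input (Connected σ) (TwoWayPath σ)}

/-- The bound on the numerator comes from the semantics: it is the denominator times a probability,
which is at most 1. -/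
theorem solveParsed_spec (hidx : Function.Injective idx) :
    ∀ p, p = solveParsed (parse ((encodeInput x).map (symbolCode idx)).reverse) →
      0 < p.2 ∧ p.1 ≤ p.2 ∧ (p.1 / p.2 : ℚ) = x.answer := by
  rintro _ rfl
  obtain ⟨m, pos, h, hwalk⟩ := exists_walk_eq x.H_mem idx x.prob
  have hC := properConstraints x.G idx
  have hvalid : ValidSteps (pathSteps h idx x.prob) := by
    intro e he
    obtain ⟨i, rfl⟩ := List.mem_ofFn.1 he
    exact ⟨(x.prob _).den_pos, (x.prob _).num_le_den⟩
  obtain ⟨hpos, -, hval⟩ := dp_spec (.range x.nG) (graphConstraints x.G idx)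
    (fun e L => reach_cons_le x.nG_pos hC e) (pathSteps h idx x.prob) hvalid
  have hans : x.answer = listProb ((pathSteps h idx x.prob).map stepProb)
      (Matches (reach (.range x.nG) (graphConstraints x.G idx)) (pathSteps h idx x.prob)) := by
    classical
    have hmap : (pathSteps h idx x.prob).map stepProb =
        List.ofFn fun i => (x.prob (h.edgeEquiv.symm i)).toRat := by
      rw [pathSteps, List.map_ofFn]
      rfl
    rw [Input.answer, LabeledGraph.homProb, hmap]
    simp only [LabeledGraph.worldProb]
    rw [sum_finset_eq_listProb h.edgeEquiv.symm (fun e => (x.prob e).toRat)]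
    refine listProb_congr fun w _ => ?_
    rw [← homTo_subgraph_iff h x.prob x.nG_pos x.G_mem hidx w]
    rfl
  have hle := listProb_le_one (ps := (pathSteps h idx x.prob).map stepProb) (fun p hp => by
    obtain ⟨e, he, rfl⟩ := List.mem_map.1 hp
    obtain ⟨h₁, h₂⟩ := hvalid e he
    exact ⟨by rw [stepProb]; positivity,
      div_le_one_of_le₀ (by exact_mod_cast h₂) (by positivity)⟩)
    (Matches (reach (.range x.nG) (graphConstraints x.G idx)) (pathSteps h idx x.prob))
  have hsolve : solveParsed (parse ((encodeInput x).map (symbolCode idx)).reverse) =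
      (dpValue (.range x.nG) (graphConstraints x.G idx)
        (dp (.range x.nG) (graphConstraints x.G idx) (pathSteps h idx x.prob).reverse),
      (dp (.range x.nG) (graphConstraints x.G idx) (pathSteps h idx x.prob).reverse).2.headD 0) := by
    rw [parse_encodeInput, ← hwalk, graphConstraints]
    simp only [solveParsed, List.getD_cons_zero, List.getD_cons_succ]
    rw [chunk_flatMap (by norm_num) _ (fun e => by simp [edgeNums]),
      chunk_flatMap (by norm_num) _ (fun e => by simp [edgeNums])]
  rw [← hans] at hval hle
  rw [hsolve]
  have hpos' : (0 : ℚ) < (dp (.range x.nG) (graphConstraints x.G idx)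
    (pathSteps h idx x.prob).reverse).2.headD 0 := by exact_mod_cast hpos
  refine ⟨hpos, ?_, ?_⟩
  · have := hval.trans_le (mul_le_of_le_one_right hpos'.le hle)
    exact_mod_cast this
  · rw [hval, mul_div_cancel_left₀ _ hpos'.ne']

theorem exists_result (hidx : Function.Injective idx) (x : Input (Connected σ) (TwoWayPath σ)) :
    ∃ q : ProbFraction,
    q.toRat = x.answer ∧
      (q.num, q.den) = solveParsed (parse ((encodeInput x).map (symbolCode idx)).reverse) := by
  obtain ⟨p, hp⟩ : ∃ p, p = solveParsed (parse ((encodeInput x).map (symbolCode idx)).reverse) :=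
    ⟨_, rfl⟩
  obtain ⟨h₁, h₂, h₃⟩ := solveParsed_spec hidx p hp
  exact ⟨⟨p.1, p.2, h₁, h₂⟩, h₃, hp⟩

/-- The fraction that the algorithm computes. -/
noncomputable def result (hidx : Function.Injective idx) (x : Input (Connected σ) (TwoWayPath σ)) :
  ProbFraction :=
  (exists_result hidx x).choose

theorem toRat_result (hidx : Function.Injective idx) (x : Input (Connected σ) (TwoWayPath σ)) :
    (result hidx x).toRat = x.answer :=
  (exists_result hidx x).choose_spec.1

theorem solve_eq (hidx : Function.Injective idx) (x : Input (Connected σ) (TwoWayPath σ)) :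
    solve ((encodeInput x).map (symbolCode idx)).reverse =
      ((((result hidx x).num.bits.map some ++ [none]) ++
        ((result hidx x).den.bits.map some ++ [none])).map Option.toList).reverse := by
  rw [solve, ← (exists_result hidx x).choose_spec.2, encodeResult, ← result]
  simp only [List.map_append, List.map_map]
  rfl

theorem encodeFraction_eq (q : ProbFraction) : (encodeFraction q : List (Symbol σ)) =
    ((q.num.bits.map some ++ [none]) ++ (q.den.bits.map some ++ [none])).map outSymbol := by
  have : outSymbol (σ := σ) ∘ some = Symbol.bit := rfl
  simp [encodeFraction, encodeNat, encodeNat_eq_bits, this]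
  rfl

end

end PHom
theorem mainTheorem1 (σ : Type) [Fintype σ] (hσ : 1 < Fintype.card σ) :
    PHom.InPTIME (PHom.Connected σ) (PHom.TwoWayPath σ) := by
  -- Any injective numbering of the labels will do, since labels are only compared for equality.
  have hidx : Function.Injective fun R : σ => (Fintype.equivFin σ R : ℕ) :=
    Fin.val_injective.comp (Fintype.equivFin σ).injective
  exact ⟨PHom.result hidx, PHom.toRat_result hidx, PHom.PolyTime.exists_machine _
    PHom.PolyTime.solve _ (PHom.solve_eq hidx) fun x => PHom.encodeFraction_eq _⟩
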